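/- **Setting.** Let $\varphi$ be the projection of $\mathbb{R}^3$ along $(1,1,1)$ onto a plane, and let $\triangle$ be the triangular grid obtained by projecting the cubic grid $\mathbb{Z}^3$: its vertices are the points $\varphi(x,y,z)$, $(x,y,z)\in\mathbb{Z}^3$, its edges join $\varphi(c)$ to $\varphi(c+e_d)$ for $d\in\{1,2,3\}$, where $e_1,e_2,e_3$ are the unit vectors. For $n\ge 1$ let $H_n$ be the regular hexagon of side $n$ of this grid, that is, the union of the triangles whose vertices $\varphi(x,y,z)$ all satisfy $\max(x,y,z)-\min(x,y,z)\le n$. A *lozenge* is the union of two triangles with a common edge; it *overlaps* this common edge, and the direction of the common edge is its *orientation*. **Calisson puzzle $\mathrm{Tiling}(H_n,\emptyset,X_2)$.** Given $n\ge1$ and a set $X_2$ of interior edges of $H_n$, find a tiling of $H_n$ by lozenges (each triangle is covered exactly once) such that no edge of $X_2$ is overlapped by a lozenge and the two lozenges adjacent to each edge of $X_2$ have different orientations. **Cuts.** A cube $c+[0,1]^3$ is identified with its base point $c\in\mathbb{Z}^3$; consider the cubes with $\varphi(c)\inH_n$. The *enhanced ascendant graph* $\mathcal H^{\emptyset,X_2}$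 on these cubes has the arcs $c\to c+e_d$ for each edge $\varphi(c)\varphi(c+e_d)$ of $H_n$; the arc $c+e_d\to c$ if moreover this edge is in $\partialH_n\cup X_2$; and, if this edge is in $X_2$ and $\{d,i,j\}=\{1,2,3\}$, the two arcs between $c-e_i$ and $c-e_j$. A *dicut* is a partition of the cubes into two non-empty parts, bottom and top, such that all arcs between the parts go from bottom to top. Let $c_0$ (resp. $c_1$) be the set of cubes over boundary vertices of $H_n$ whose smallest coordinate is $-1$ (resp. $0$). A dicut *separates* $c_0$ and $c_1$ if $c_0$ is contained in its bottom part and $c_1$ in its top part. **Advancing surface algorithm.** The input is $n$ and the table of the edges in $X_2$. Start with the bottom part $\{c:\min_i c_i<0\}$ (the empty $n\times n\times n$ cube). Repeatedly add to the bottom part every cube with an arc of $\mathcal H^{\emptyset,X_2}$ leading to a cube of the bottom part, by a graph traversal. If a cube with a coordinate $\ge n$ (a top cube of the cut given by the full $n\times n\times n$ cube) would have to be added, answer "infeasible". If no cube remains to be added, output the projections of the square faces that separate the bottom part from the top part. Time is the number of elementary steps of a random access machine with words of absolute value $O(n^3)$. **Corollary.** (1) For every $n\ge 1$, among the dicuts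 of $\mathcal H^{\emptyset,\emptyset}$ that separate $c_0$ and $c_1$, the one with the smallest bottom part is the empty cube, with bottom part $\{c:\min_i c_i<0\}$, and the one with the largest bottom part is the full cube, with bottom part $\{c:\max_i c_i<n\}$. (2) The advancing surface algorithm solves the Calisson puzzle instances $\mathrm{Tiling}(H_n,\emptyset,X_2)$ in time $O(n^3)$: there is a constant $C$ such that for every $n\ge1$ and every set $X_2$ of interior edges of $H_n$ the algorithm halts after at most $C n^3$ steps, and either it outputs a solution of $\mathrm{Tiling}(H_n,\emptyset,X_2)$, its final bottom part then being the smallest bottom part of a dicut of $\mathcal H^{\emptyset,X_2}$ separating $c_0$ and $c_1$, or it answers "infeasible" and $\mathrm{Tiling}(H_n,\emptyset,X_2)$ has no solution. -/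

import Mathlib

namespace Calisson

/-! ## The triangular grid -/

/-- A vertex of the triangular grid: `(a, b)` stands for the projection of `(a, b, 0)` along
`(1, 1, 1)`. -/
abbrev Vertex := ℤ × ℤ

/-- A unit cube of the cubic grid, given by its base point. -/
abbrev Cube := Fin 3 → ℤ

/-- The projection along `(1, 1, 1)`. -/
def proj (c : Cube) : Vertex := (c 0 - c 2, c 1 - c 2)

/-- The unit vector of the `d`-th coordinate of the cubic grid. -/
def unit (d : Fin 3) : Cube := Pi.single d 1

/-- An edge of the triangular grid. Each edge has exactly one orientation in which it points in one
of the three positive directions `proj (unit 0)`, `proj (unit 1)`, `proj (unit 2)`; `base` is its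
origin in this orientation and `dir` is the direction. -/
@[ext] structure Edge where
  base : Vertex
  dir : Fin 3
deriving DecidableEq

/-- The two end points of an edge. -/
def Edge.ends (e : Edge) : Finset Vertex := {e.base, e.base + proj (unit e.dir)}

/-- A unit triangle of the triangular grid. The three positive directions being `(1, 0)`, `(0, 1)`
and `(-1, -1)`, every unit square of the lattice of vertices is divided by its diagonal into two
triangles, and `lower` tells which of the two is meant. -/
structure Triangle where
  corner : Vertex
  lower : Bool
deriving DecidableEq

/-- The three vertices of a triangle. -/
def Triangle.vertices (t : Triangle) : Finset Vertex :=
  {t.corner, t.corner + (if t.lower then (1, 0) else (0, 1)), t.corner + (1, 1)}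

/-- The edge `e` is a side of the triangle `t`. -/
def Edge.IsSideOf (e : Edge) (t : Triangle) : Prop := e.ends ⊆ t.vertices

/-! ## Regions -/

/-- A region, given by its triangles. -/
abbrev Region := Set Triangle

/-- The vertices of a region. -/
def Region.vertices (R : Region) : Set Vertex := {v | ∃ t ∈ R, v ∈ t.vertices}

/-- The edges of a region. -/
def Region.edges (R : Region) : Set Edge := {e | ∃ t ∈ R, e.IsSideOf t}

/-- The boundary edges of a region: one adjacent triangle is in the region, the other is not. -/
def Region.boundary (R : Region) : Set Edge :=
  {e | (∃ t ∈ R, e.IsSideOf t) ∧ ∃ t ∉ R, e.IsSideOf t}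

/-- The interior edges of a region: both adjacent triangles are in the region. -/
def Region.interiorEdges (R : Region) : Set Edge := {e | ∀ t, e.IsSideOf t → t ∈ R}

/-- The regular hexagon of side `n` centred at the origin: a vertex `(a, b)` belongs to it when the
homogeneous coordinates `(a, b, 0)` differ pairwise by at most `n`. -/
def hexagon (n : ℕ) : Region :=
  {t | ∀ v ∈ t.vertices, |v.1| ≤ (n : ℤ) ∧ |v.2| ≤ (n : ℤ) ∧ |v.1 - v.2| ≤ (n : ℤ)}

/-! ## Lozenges and the tiling problem -/

/-- A lozenge is the union of two triangles with a common side. It is given by this common side,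
which is the edge that the lozenge overlaps and whose direction is the orientation (type, colour)
of the lozenge. -/
structure Lozenge where
  diagonal : Edge
deriving DecidableEq

/-- The two triangles that make up a lozenge are those that have the diagonal as a side. -/
def Lozenge.Covers (L : Lozenge) (t : Triangle) : Prop := L.diagonal.IsSideOf t

/-- The orientation of a lozenge. -/
def Lozenge.orientation (L : Lozenge) : Fin 3 := L.diagonal.dir

/-- The lozenge overlaps the edge. -/
def Lozenge.Overlaps (L : Lozenge) (e : Edge) : Prop := L.diagonal = e

/-- The lozenge is adjacent to the edge: the edge is a side of one of its triangles, but is not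
overlapped. -/
def Lozenge.IsAdjacentTo (L : Lozenge) (e : Edge) : Prop :=
  ¬ L.Overlaps e ∧ ∃ t, L.Covers t ∧ e.IsSideOf t

/-- A set of lozenges contained in the region that covers each triangle of the region exactly
once. -/
def IsTiling (R : Region) (T : Set Lozenge) : Prop :=
  (∀ L ∈ T, ∀ t, L.Covers t → t ∈ R) ∧ ∀ t ∈ R, ∃! L, L ∈ T ∧ L.Covers t

/-- `T` is a solution of the instance `Tiling(R, X₁, X₂)`: it tiles `R`, no edge of `X₁ ∪ X₂` is
overlapped, and two different lozenges adjacent to the same edge of `X₂` have different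
orientations. -/
def IsSolution (R : Region) (X₁ X₂ : Set Edge) (T : Set Lozenge) : Prop :=
  IsTiling R T ∧
  (∀ e ∈ X₁ ∪ X₂, ∀ L ∈ T, ¬ L.Overlaps e) ∧
  ∀ e ∈ X₂, ∀ L ∈ T, ∀ L' ∈ T, L ≠ L' → L.IsAdjacentTo e → L'.IsAdjacentTo e →
    L.orientation ≠ L'.orientation

/-! ## The enhanced ascendant graph and its dicuts -/

/-- The cubes whose base point projects into the region. -/
def Region.cubes (R : Region) : Set Cube := {c | proj c ∈ R.vertices}

/-- The arcs of the enhanced ascendant graph of cubes of `Tiling(R, X₁, X₂)`. -/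
inductive Arc (R : Region) (X₁ X₂ : Set Edge) : Cube → Cube → Prop
  /-- from a cube to a face-adjacent cube one unit higher, along an edge of the region -/
  | ascending (c : Cube) (d : Fin 3) : ⟨proj c, d⟩ ∈ R.edges → Arc R X₁ X₂ c (c + unit d)
  /-- the converse arc, along an edge that must not be overlapped -/
  | descending (c : Cube) (d : Fin 3) : ⟨proj c, d⟩ ∈ R.boundary ∪ X₁ ∪ X₂ →
      Arc R X₁ X₂ (c + unit d) c
  /-- the two arcs between the cubes to the left and to the right of an edge of `X₂` -/
  | lateral (c : Cube) (d i j : Fin 3) : ⟨proj c, d⟩ ∈ X₂ → i ≠ d → j ≠ d → i ≠ j →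
      Arc R X₁ X₂ (c - unit i) (c - unit j)

/-- `D` is the bottom part of a dicut of the enhanced ascendant graph: both parts are non-empty and
every arc between them goes from bottom to top. -/
def IsDicut (R : Region) (X₁ X₂ : Set Edge) (D : Set Cube) : Prop :=
  D ⊆ R.cubes ∧ D.Nonempty ∧ (R.cubes \ D).Nonempty ∧
  ∀ c c', Arc R X₁ X₂ c c' → c' ∈ D → c ∈ D

/-- The boundary cycle of the hexagon lifted to the cubes with smallest coordinate `k`. -/
def liftedBoundary (n : ℕ) (k : ℤ) : Set Cube :=
  {c | (∃ e ∈ (hexagon n).boundary, proj c ∈ e.ends) ∧ (∃ i, c i = k) ∧ ∀ i, k ≤ c i}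

/-- The dicuts for `Tiling(hexagon n, ∅, X₂)` that separate the consecutive lifted boundary cycles
of level `-1` (bottom) and `0` (top). -/
def separatingDicuts (n : ℕ) (X₂ : Set Edge) : Set (Set Cube) :=
  {D | IsDicut (hexagon n) ∅ X₂ D ∧ liftedBoundary n (-1) ⊆ D ∧ Disjoint (liftedBoundary n 0) D}

/-- The cut below the surface of the empty `n × n × n` cube (the back walls). -/
def emptyCut (n : ℕ) : Set Cube := {c ∈ (hexagon n).cubes | ∃ i, c i < 0}

/-- The cut below the surface of the full `n × n × n` cube. -/
def fullCut (n : ℕ) : Set Cube := {c ∈ (hexagon n).cubes | ∀ i, c i < (n : ℤ)}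

/-! ## A random access machine with a step count

Imperative programs over integer registers and finitely many arrays. An array has three integer
indices. Each operator, constant, register access and array access counts as one step, and so does
each executed statement. -/

/-- Registers. -/
inductive Reg
  | size | x | y | z | top | failed
deriving DecidableEq

/-- Arrays: the input, the cubes that were added, the stack of cubes to be explored, the output. -/
inductive Arr
  | constraints | added | stack | tiling
deriving DecidableEq

/-- The memory of the machine. -/
structure Memory where
  reg : Reg → ℤ
  arr : Arr → ℤ → ℤ → ℤ → ℤ

/-- Write a register. -/
def Memory.setReg (σ : Memory) (r : Reg) (k : ℤ) : Memory :=
  { σ with reg := fun r' => if r' = r then k else σ.reg r' }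

/-- Write an array cell. -/
def Memory.setArr (σ : Memory) (a : Arr) (i j l k : ℤ) : Memory :=
  { σ with arr := fun a' i' j' l' =>
      if a' = a ∧ i' = i ∧ j' = j ∧ l' = l then k else σ.arr a' i' j' l' }

/-- Arithmetic expressions. -/
inductive Arith
  | lit (k : ℤ)
  | reg (r : Reg)
  | get (a : Arr) (i j l : Arith)
  | add (p q : Arith)
  | sub (p q : Arith)

/-- The value of an expression. -/
def Arith.eval (σ : Memory) : Arith → ℤ
  | .lit k => k
  | .reg r => σ.reg r
  | .get a i j l => σ.arr a (i.eval σ) (j.eval σ) (l.eval σ)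
  | .add p q => p.eval σ + q.eval σ
  | .sub p q => p.eval σ - q.eval σ

/-- The number of steps of the evaluation of an expression. -/
def Arith.cost : Arith → ℕ
  | .lit _ => 1
  | .reg _ => 1
  | .get _ i j l => i.cost + j.cost + l.cost + 1
  | .add p q => p.cost + q.cost + 1
  | .sub p q => p.cost + q.cost + 1

/-- Tests. -/
inductive Cond
  | lt (p q : Arith)
  | eq (p q : Arith)
  | not (b : Cond)
  | and (b b' : Cond)
  | or (b b' : Cond)

/-- The value of a test. -/
def Cond.eval (σ : Memory) : Cond → Bool
  | .lt p q => decide (p.eval σ < q.eval σ)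
  | .eq p q => decide (p.eval σ = q.eval σ)
  | .not b => !b.eval σ
  | .and b b' => b.eval σ && b'.eval σ
  | .or b b' => b.eval σ || b'.eval σ

/-- The number of steps of the evaluation of a test. -/
def Cond.cost : Cond → ℕ
  | .lt p q => p.cost + q.cost + 1
  | .eq p q => p.cost + q.cost + 1
  | .not b => b.cost + 1
  | .and b b' => b.cost + b'.cost + 1
  | .or b b' => b.cost + b'.cost + 1

/-- Programs. -/
inductive Prog
  | skip
  | assign (r : Reg) (p : Arith)
  | store (a : Arr) (i j l p : Arith)
  | seq (s s' : Prog)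
  | ite (b : Cond) (s s' : Prog)
  | loop (b : Cond) (s : Prog)

/-- `Exec W s σ t σ'`: on a machine whose words hold the integers of absolute value at most `W`, the
program `s` started in the memory `σ` halts after exactly `t` steps in the memory `σ'`. All values
that are stored, and all indices of the cells that are written, have to fit into a word. -/
inductive Exec (W : ℕ) : Prog → Memory → ℕ → Memory → Prop
  | skip (σ : Memory) : Exec W .skip σ 1 σ
  | assign (σ : Memory) (r : Reg) (p : Arith) : |p.eval σ| ≤ (W : ℤ) →
      Exec W (.assign r p) σ (p.cost + 1) (σ.setReg r (p.eval σ))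
  | store (σ : Memory) (a : Arr) (i j l p : Arith) :
      |i.eval σ| ≤ (W : ℤ) → |j.eval σ| ≤ (W : ℤ) → |l.eval σ| ≤ (W : ℤ) → |p.eval σ| ≤ (W : ℤ) →
      Exec W (.store a i j l p) σ (i.cost + j.cost + l.cost + p.cost + 1)
        (σ.setArr a (i.eval σ) (j.eval σ) (l.eval σ) (p.eval σ))
  | seq {s s' : Prog} {σ σ' σ'' : Memory} {t t' : ℕ} :
      Exec W s σ t σ' → Exec W s' σ' t' σ'' → Exec W (.seq s s') σ (t + t') σ''
  | ite_true {b : Cond} {s s' : Prog} {σ σ' : Memory} {t : ℕ} :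
      b.eval σ = true → Exec W s σ t σ' → Exec W (.ite b s s') σ (b.cost + 1 + t) σ'
  | ite_false {b : Cond} {s s' : Prog} {σ σ' : Memory} {t : ℕ} :
      b.eval σ = false → Exec W s' σ t σ' → Exec W (.ite b s s') σ (b.cost + 1 + t) σ'
  | loop_done {b : Cond} {s : Prog} {σ : Memory} :
      b.eval σ = false → Exec W (.loop b s) σ (b.cost + 1) σ
  | loop_step {b : Cond} {s : Prog} {σ σ' σ'' : Memory} {t t' : ℕ} :
      b.eval σ = true → Exec W s σ t σ' → Exec W (.loop b s) σ' t' σ'' →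
      Exec W (.loop b s) σ (b.cost + 1 + t + t') σ''

/-! ## The advancing surface algorithm for the hexagon -/

/-- Sequential composition of a list of programs. -/
def block : List Prog → Prog
  | [] => .skip
  | s :: l => .seq s (block l)

/-- `for r = -1, …, size - 1 do s` -/
def forEach (r : Reg) (s : Prog) : Prog :=
  .seq (.assign r (.lit (-1)))
    (.loop (.lt (.reg r) (.reg .size)) (.seq s (.assign r (.add (.reg r) (.lit 1)))))

/-- The cube `(p, q, r)` is in the current bottom part: it is in the bottom part of the lower cut
(a negative coordinate), or it was added. -/
def inBottom (p q r : Arith) : Cond :=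
  .or (.lt p (.lit 0)) (.or (.lt q (.lit 0)) (.or (.lt r (.lit 0))
    (.eq (.get .added p q r) (.lit 1))))

/-- The cube `(p, q, r)` is in the top part of the upper cut (a coordinate at least `size`). -/
def inTop (p q r : Arith) : Cond :=
  .not (.and (.lt p (.reg .size)) (.and (.lt q (.reg .size)) (.lt r (.reg .size))))

/-- Push the cube `(p, q, r)` on the stack of cubes to be explored. -/
def push (p q r : Arith) : Prog :=
  block [.store .stack (.reg .top) (.lit 0) (.lit 0) p,
    .store .stack (.reg .top) (.lit 1) (.lit 0) q,
    .store .stack (.reg .top) (.lit 2) (.lit 0) r,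
    .assign .top (.add (.reg .top) (.lit 1))]

/-- Pop a cube from the stack into the registers `x`, `y`, `z`. -/
def pop : Prog :=
  block [.assign .top (.sub (.reg .top) (.lit 1)),
    .assign .x (.get .stack (.reg .top) (.lit 0) (.lit 0)),
    .assign .y (.get .stack (.reg .top) (.lit 1) (.lit 0)),
    .assign .z (.get .stack (.reg .top) (.lit 2) (.lit 0))]

/-- The first coordinate of the current cube translated by `v`. -/
def shiftX (v : Cube) : Arith := .add (.reg .x) (.lit (v 0))

/-- The second coordinate of the current cube translated by `v`. -/
def shiftY (v : Cube) : Arith := .add (.reg .y) (.lit (v 1))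

/-- The third coordinate of the current cube translated by `v`. -/
def shiftZ (v : Cube) : Arith := .add (.reg .z) (.lit (v 2))

/-- Visit the predecessor `(x, y, z) + v` of the current cube: nothing is to be done if it is
already in the bottom part; the instance is infeasible if it is in the top part of the upper cut;
otherwise the cube is added and will be explored. -/
def visit (v : Cube) : Prog :=
  .ite (inBottom (shiftX v) (shiftY v) (shiftZ v)) .skip
    (.ite (inTop (shiftX v) (shiftY v) (shiftZ v)) (.assign .failed (.lit 1))
      (.seq (.store .added (shiftX v) (shiftY v) (shiftZ v) (.lit 1))
        (push (shiftX v) (shiftY v) (shiftZ v))))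

/-- The edge of direction `d` based at the projection of `(x, y, z) + v` is in the input set. -/
def constrained (d : Fin 3) (v : Cube) : Cond :=
  .eq (.get .constraints (.lit (d.val : ℤ)) (.sub (shiftX v) (shiftZ v))
    (.sub (shiftY v) (shiftZ v))) (.lit 1)

/-- The predecessor by an ascending arc. -/
def visitBelow (d : Fin 3) : Prog := visit (-unit d)

/-- The predecessor by a descending arc. -/
def visitAbove (d : Fin 3) : Prog := .ite (constrained d 0) (visit (unit d)) .skip

/-- The predecessor by a lateral arc along an edge of direction `d` based at the projection of
`(x, y, z) + unit i`. -/
def visitBeside (d i j : Fin 3) : Prog :=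
  .ite (constrained d (unit i)) (visit (unit i - unit j)) .skip

/-- Visit all the predecessors of the current cube in the enhanced ascendant graph. -/
def explore : Prog :=
  block [visitBelow 0, visitBelow 1, visitBelow 2,
    visitAbove 0, visitAbove 1, visitAbove 2,
    visitBeside 0 1 2, visitBeside 0 2 1,
    visitBeside 1 0 2, visitBeside 1 2 0,
    visitBeside 2 0 1, visitBeside 2 1 0]

/-- Start with the surface of the lower cut (the highest bottom cube over each vertex). -/
def start : Prog :=
  forEach .x (forEach .y (block [push (.lit (-1)) (.reg .x) (.reg .y),
    push (.reg .x) (.lit (-1)) (.reg .y), push (.reg .x) (.reg .y) (.lit (-1))]))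

/-- Let the surface advance until no predecessor is left or the instance turns out infeasible. -/
def advance : Prog :=
  .loop (.and (.lt (.lit 0) (.reg .top)) (.eq (.reg .failed) (.lit 0))) (.seq pop explore)

/-- If the face between the current cube and its upper neighbour in direction `d` is on the
surface, output its projection, the lozenge that overlaps the projected arc. -/
def outputFace (d : Fin 3) : Prog :=
  .ite (.and (inBottom (shiftX 0) (shiftY 0) (shiftZ 0))
      (.not (inBottom (shiftX (unit d)) (shiftY (unit d)) (shiftZ (unit d)))))
    (.store .tiling (.lit (d.val : ℤ)) (.sub (.reg .x) (.reg .z)) (.sub (.reg .y) (.reg .z))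
      (.lit 1))
    .skip

/-- Project the final surface. -/
def output : Prog :=
  forEach .x (forEach .y (forEach .z (block [outputFace 0, outputFace 1, outputFace 2])))

/-- The advancing surface algorithm for the Calisson puzzle. -/
def advancingSurface : Prog :=
  block [start, advance, .ite (.eq (.reg .failed) (.lit 0)) output .skip]

/-- The initial memory: the side of the hexagon and the table of the edges in `X₂`; the rest is
zero. -/
def input (n : ℕ) (X₂ : Finset Edge) : Memory where
  reg r := if r = .size then (n : ℤ) else 0
  arr a d i j :=
    if a = .constraints ∧ ∃ e ∈ X₂, ((e.dir.val : ℕ) : ℤ) = d ∧ e.base = (i, j) then 1 else 0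

/-- The set of lozenges in the output table. -/
def outputTiling (σ : Memory) : Set Lozenge :=
  {L | σ.arr .tiling (L.diagonal.dir.val : ℤ) L.diagonal.base.1 L.diagonal.base.2 = 1}

/-- The bottom part of the current cut: the lower cut together with the cubes that were added. -/
def bottomPart (n : ℕ) (σ : Memory) : Set Cube :=
  emptyCut n ∪ {c | σ.arr .added (c 0) (c 1) (c 2) = 1}

end Calisson

/-! Cuts are height functions. A separating dicut is closed under predecessors, hence downward
closed for the coordinatewise order inside the hexagon (`mem_of_le`): in any comparison one can
climb by raising a smallest coordinate that still has to grow. Comparing with corner cubes of the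
two lifted boundaries traps every separating dicut between `emptyCut` and `fullCut`. Without
constraints these two are closed themselves, which gives the first claim. On each fibre of the
projection the dicut is then an initial segment, so it is `below n h` for a height function `h`
(`exists_height`).

The link with tilings is `gap`, a discrete derivative of `h`. Around a triangle the height
differences telescope and the gaps sum to 1 (`sum_gap`). Closure under ascending arcs makes the gaps
nonnegative, so each triangle has exactly one side of gap 1, the diagonal of its lozenge. Descending
arcs make the gap vanish on the boundary and on `X₂`. Lateral arcs equate the gaps of the two other
edges that end at the base of an edge of `X₂`; with the triangle sums this forces different
orientations on its two sides. Hence `isSolution_surface`. Conversely, the diagonals of a tiling are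
integrated to a height function. Its difference from the height of the empty cube is integrated
instead of the height itself, because this difference vanishes on and outside the boundary;
`below_tilingHeight_mem_separatingDicuts` turns a solution into a separating dicut.

For the algorithm, every added cube is a predecessor of a cube common to all separating dicuts, so
it also belongs to all of them. If such a cube has a coordinate at least `n`, it violates the bound
by `fullCut`: there is no separating dicut, hence no solution. If the stack runs empty, the bottom
part is closed (`bottom_mem_separatingDicuts`), hence the least separating dicut. Time is controlled
by a potential, the stack height plus the number of cubes of the box not yet added: an addition with
its push preserves it, a pop lowers it by one, and after the start it is at most `3 * (n + 1) ^ 2 +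
n ^ 3`. -/

namespace Calisson

/-! ## Sides of triangles -/

/-- The side of direction `d` of a triangle. -/
def Triangle.side (t : Triangle) (d : Fin 3) : Edge :=
  if d = 0 then ⟨t.corner + (if t.lower then (0, 0) else (0, 1)), 0⟩
  else if d = 1 then ⟨t.corner + (if t.lower then (1, 0) else (0, 0)), 1⟩
  else ⟨t.corner + (1, 1), 2⟩

theorem Triangle.side_dir (t : Triangle) (d : Fin 3) : (t.side d).dir = d := by
  fin_cases d <;> rfl

theorem proj_unit_zero : proj (unit 0) = (1, 0) := by decide

theorem proj_unit_one : proj (unit 1) = (0, 1) := by decide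

theorem proj_unit_two : proj (unit 2) = (-1, -1) := by decide

theorem proj_add (c c' : Cube) : proj (c + c') = proj c + proj c' := by
  ext <;> simp [proj] <;> ring

theorem proj_sub (c c' : Cube) : proj (c - c') = proj c - proj c' := by
  ext <;> simp [proj] <;> ring

/-- A triangle has one side in each direction, so incidence becomes an equation between edges;
nearly all later incidence arguments use this form. -/
theorem Edge.isSideOf_iff (e : Edge) (t : Triangle) : e.IsSideOf t ↔ e = t.side e.dir := by
  obtain ⟨⟨p, q⟩, d⟩ := e
  obtain ⟨⟨a, b⟩, l⟩ := t
  fin_cases d <;> cases l <;>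
    simp [Edge.IsSideOf, Edge.ends, Triangle.vertices, Triangle.side, proj_unit_zero,
      proj_unit_one, proj_unit_two, Finset.insert_subset_iff] <;> omega

theorem Triangle.side_isSideOf (t : Triangle) (d : Fin 3) : (t.side d).IsSideOf t := by
  rw [Edge.isSideOf_iff, Triangle.side_dir]

/-- The two triangles that have the side of direction `d` based at `v`: the other two sides are the
one of direction `i` that ends at `v` and the one of direction `j` that starts at the other end. -/
theorem exists_triangle (v : Vertex) {d i j : Fin 3} (hi : i ≠ d) (hj : j ≠ d) (hij : i ≠ j) :
    ∃ t : Triangle, t.side d = ⟨v, d⟩ ∧ t.side i = ⟨v - proj (unit i), i⟩ ∧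
      t.side j = ⟨v + proj (unit d), j⟩ := by
  obtain ⟨p, q⟩ := v
  fin_cases d <;> fin_cases i <;> fin_cases j <;> simp at hi hj hij
  · exact ⟨⟨(p, q - 1), false⟩, by
      simp [Triangle.side, proj_unit_zero, proj_unit_one, proj_unit_two]⟩
  · exact ⟨⟨(p, q), true⟩, by
      simp [Triangle.side, proj_unit_zero, proj_unit_one, proj_unit_two]⟩
  · exact ⟨⟨(p - 1, q), true⟩, by
      simp [Triangle.side, proj_unit_zero, proj_unit_one, proj_unit_two]⟩
  · exact ⟨⟨(p, q), false⟩, by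
      simp [Triangle.side, proj_unit_zero, proj_unit_one, proj_unit_two]⟩
  · exact ⟨⟨(p - 1, q - 1), false⟩, by
      simp [Triangle.side, proj_unit_zero, proj_unit_one, proj_unit_two, sub_eq_add_neg]⟩
  · exact ⟨⟨(p - 1, q - 1), true⟩, by
      simp [Triangle.side, proj_unit_zero, proj_unit_one, proj_unit_two, sub_eq_add_neg]⟩

/-- There are no other triangles than those of `exists_triangle`. -/
theorem Triangle.side_cases {t : Triangle} {v : Vertex} {d i j : Fin 3} (h : t.side d = ⟨v, d⟩)
    (hi : i ≠ d) (hj : j ≠ d) (hij : i ≠ j) :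
    (t.side i = ⟨v - proj (unit i), i⟩ ∧ t.side j = ⟨v + proj (unit d), j⟩) ∨
      (t.side j = ⟨v - proj (unit j), j⟩ ∧ t.side i = ⟨v + proj (unit d), i⟩) := by
  obtain ⟨p, q⟩ := v
  obtain ⟨⟨a, b⟩, l⟩ := t
  fin_cases d <;> fin_cases i <;> fin_cases j <;> simp at hi hj hij <;> cases l <;>
    simp [Triangle.side, proj_unit_zero, proj_unit_one, proj_unit_two] at h ⊢ <;> omega

theorem exists_third {d i : Fin 3} (h : i ≠ d) : ∃ j, j ≠ d ∧ i ≠ j := by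
  revert d i; decide

/-! ## The hexagon -/

theorem mem_hexagon_vertices {n : ℕ} (hn : 1 ≤ n) (v : Vertex) :
    v ∈ (hexagon n).vertices ↔ |v.1| ≤ (n : ℤ) ∧ |v.2| ≤ (n : ℤ) ∧ |v.1 - v.2| ≤ (n : ℤ) := by
  constructor
  · rintro ⟨t, ht, hv⟩
    exact ht v hv
  · obtain ⟨a, b⟩ := v
    intro h
    simp only [abs_le] at h
    -- These are the six triangles around the vertex; for `n ≥ 1` at least one of them fits into the
    -- hexagon.
    have : ∃ t ∈ hexagon n, t = ⟨(a, b), true⟩ ∨ t = ⟨(a - 1, b - 1), true⟩ ∨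
        t = ⟨(a - 1, b), true⟩ ∨ t = ⟨(a, b), false⟩ ∨ t = ⟨(a - 1, b - 1), false⟩ ∨
        t = ⟨(a, b - 1), false⟩ := by
      by_contra hcon
      simp only [not_exists, not_and] at hcon
      have h1 := hcon ⟨(a, b), true⟩
      have h2 := hcon ⟨(a - 1, b - 1), true⟩
      have h3 := hcon ⟨(a - 1, b), true⟩
      have h4 := hcon ⟨(a, b), false⟩
      have h5 := hcon ⟨(a - 1, b - 1), false⟩
      have h6 := hcon ⟨(a, b - 1), false⟩
      simp [hexagon, Triangle.vertices, abs_le] at h1 h2 h3 h4 h5 h6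
      omega
    obtain ⟨t, ht, ht'⟩ := this
    refine ⟨t, ht, ?_⟩
    rcases ht' with rfl | rfl | rfl | rfl | rfl | rfl <;> simp [Triangle.vertices]

theorem mem_cubes {n : ℕ} (hn : 1 ≤ n) (c : Cube) :
    c ∈ (hexagon n).cubes ↔ ∀ i j, c i - c j ≤ n := by
  simp only [Region.cubes, Set.mem_ofPred_eq, mem_hexagon_vertices hn, proj, abs_le,
    Fin.forall_fin_succ, IsEmpty.forall_iff, Fin.isValue, Fin.succ_zero_eq_one,
    Fin.succ_one_eq_two]
  constructor
  · intro h; refine ⟨⟨?_, ?_, ?_, trivial⟩, ⟨?_, ?_, ?_, trivial⟩, ⟨?_, ?_, ?_, trivial⟩,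
      trivial⟩ <;> omega
  · intro h; omega

theorem lower_mem_hexagon {n : ℕ} {a b : ℤ} : ⟨(a, b), true⟩ ∈ hexagon n ↔
    -(n : ℤ) ≤ a ∧ a + 1 ≤ n ∧ -(n : ℤ) ≤ b ∧ b + 1 ≤ n ∧ a + 1 - b ≤ n ∧ -(n : ℤ) ≤ a - b := by
  simp [hexagon, Triangle.vertices, abs_le]
  omega

theorem upper_mem_hexagon {n : ℕ} {a b : ℤ} : ⟨(a, b), false⟩ ∈ hexagon n ↔
    -(n : ℤ) ≤ a ∧ a + 1 ≤ n ∧ -(n : ℤ) ≤ b ∧ b + 1 ≤ n ∧ a - b ≤ n ∧ -(n : ℤ) ≤ a - b - 1 := by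
  simp [hexagon, Triangle.vertices, abs_le]
  omega

/-- If both ends satisfy the inequalities of the hexagon, then so does the third vertex of at least
one of the two triangles at the edge. -/
theorem mem_hexagon_edges {n : ℕ} (e : Edge) :
    e ∈ (hexagon n).edges ↔
      (|e.base.1| ≤ (n : ℤ) ∧ |e.base.2| ≤ (n : ℤ) ∧ |e.base.1 - e.base.2| ≤ (n : ℤ)) ∧
      |(e.base + proj (unit e.dir)).1| ≤ (n : ℤ) ∧ |(e.base + proj (unit e.dir)).2| ≤ (n : ℤ) ∧
        |(e.base + proj (unit e.dir)).1 - (e.base + proj (unit e.dir)).2| ≤ (n : ℤ) := by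
  constructor
  · rintro ⟨t, ht, h⟩
    exact ⟨ht _ (h (by simp [Edge.ends])), ht _ (h (by simp [Edge.ends]))⟩
  · obtain ⟨⟨p, q⟩, d⟩ := e
    rintro ⟨h, h'⟩
    have key : ∀ t t' : Triangle, (⟨(p, q), d⟩ : Edge) = t.side d →
        (⟨(p, q), d⟩ : Edge) = t'.side d → (t ∈ hexagon n ∨ t' ∈ hexagon n) →
        (⟨(p, q), d⟩ : Edge) ∈ (hexagon n).edges := by
      rintro t t' h1 h2 (h | h)
      · exact ⟨t, h, (Edge.isSideOf_iff _ _).2 h1⟩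
      · exact ⟨t', h, (Edge.isSideOf_iff _ _).2 h2⟩
    simp only [abs_le] at h h'
    fin_cases d
    · refine key ⟨(p, q), true⟩ ⟨(p, q - 1), false⟩ (by simp [Triangle.side])
        (by simp [Triangle.side]) ?_
      simp [proj_unit_zero] at h'
      rw [lower_mem_hexagon, upper_mem_hexagon]
      omega
    · refine key ⟨(p - 1, q), true⟩ ⟨(p, q), false⟩ (by simp [Triangle.side])
        (by simp [Triangle.side]) ?_
      simp [proj_unit_one] at h'
      rw [lower_mem_hexagon, upper_mem_hexagon]
      omega
    · refine key ⟨(p - 1, q - 1), true⟩ ⟨(p - 1, q - 1), false⟩ (by simp [Triangle.side])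
        (by simp [Triangle.side]) ?_
      simp [proj_unit_two] at h'
      rw [lower_mem_hexagon, upper_mem_hexagon]
      omega

theorem proj_edge_mem_edges {n : ℕ} (hn : 1 ≤ n) (c : Cube) (d : Fin 3) :
    ⟨proj c, d⟩ ∈ (hexagon n).edges ↔
      c ∈ (hexagon n).cubes ∧ c + unit d ∈ (hexagon n).cubes := by
  simp only [mem_hexagon_edges, Region.cubes, Set.mem_ofPred_eq, mem_hexagon_vertices hn, proj_add]

theorem mem_edges_of_mem_interiorEdges {n : ℕ} {e : Edge} (h : e ∈ (hexagon n).interiorEdges) :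
    e ∈ (hexagon n).edges ∧ e ∉ (hexagon n).boundary := by
  refine ⟨?_, fun ⟨_, t, ht, ht'⟩ => ht (h t ht')⟩
  obtain ⟨v, d⟩ := e
  obtain ⟨i, j, hi, hj, hij⟩ : ∃ i j, i ≠ d ∧ j ≠ d ∧ i ≠ j := by
    clear * -; revert d; decide
  obtain ⟨t, ht, -⟩ := exists_triangle v hi hj hij
  have := t.side_isSideOf d
  rw [ht] at this
  exact ⟨t, h t this, this⟩

/-- The vertices on boundary edges are at distance `n` from the centre. -/
theorem not_lt_of_mem_boundary {n : ℕ} {e : Edge} (he : e ∈ (hexagon n).boundary) {v : Vertex}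
    (hv : v ∈ e.ends) : ¬ (|v.1| < (n : ℤ) ∧ |v.2| < (n : ℤ) ∧ |v.1 - v.2| < (n : ℤ)) := by
  rintro ⟨h1, h2, h3⟩
  obtain ⟨_, t, ht, het⟩ := he
  have hv := het hv
  apply ht
  intro w hw
  obtain ⟨⟨a, b⟩, l⟩ := t
  obtain ⟨p, q⟩ := v
  obtain ⟨r, s⟩ := w
  simp only [abs_lt, abs_le] at *
  cases l <;> simp [Triangle.vertices] at hv hw <;> omega

theorem mem_cubes_of_mem_boundary {n : ℕ} {e : Edge} (he : e ∈ (hexagon n).boundary) {c : Cube}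
    (hv : proj c ∈ e.ends) : c ∈ (hexagon n).cubes := by
  obtain ⟨⟨t, ht, het⟩, _⟩ := he
  exact ⟨t, ht, het hv⟩

theorem liftedBoundary_subset_cubes (n : ℕ) (k : ℤ) :
    liftedBoundary n k ⊆ (hexagon n).cubes :=
  fun _ ⟨⟨_, he, hv⟩, _⟩ => mem_cubes_of_mem_boundary he hv

/-- Were all coordinates in `[k, k + n)`, their differences would be smaller than `n` and the
projection would be an interior vertex. -/
theorem exists_le_of_mem_liftedBoundary {n : ℕ} {k : ℤ} {c : Cube} (hc : c ∈ liftedBoundary n k) :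
    ∃ i, k + n ≤ c i := by
  obtain ⟨⟨e, he, hv⟩, ⟨i, hi⟩, hk⟩ := hc
  have := not_lt_of_mem_boundary he hv
  by_contra! h
  apply this
  have h0 := h 0
  have h1 := h 1
  have h2 := h 2
  have k0 := hk 0
  have k1 := hk 1
  have k2 := hk 2
  simp only [proj, abs_lt]
  omega

/-- This corner dominates every cube of the hexagon whose `i`-th coordinate is negative, so one such
cube per `i` suffices to force `emptyCut` into a dicut. -/
theorem corner_mem_liftedBoundary {n : ℕ} (hn : 1 ≤ n) (i : Fin 3) :
    (fun k => if k = i then -1 else (n : ℤ) - 1) ∈ liftedBoundary n (-1) := by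
  refine ⟨?_, ⟨i, by simp⟩, fun k => by dsimp only; split_ifs <;> omega⟩
  have key : ∀ e : Edge, ∀ t t' : Triangle, t ∈ hexagon n → e.IsSideOf t → t' ∉ hexagon n →
      e.IsSideOf t' → e ∈ (hexagon n).boundary :=
    fun e t t' h1 h2 h3 h4 => ⟨⟨t, h1, h2⟩, t', h3, h4⟩
  fin_cases i
  · refine ⟨⟨(-n, -1), 1⟩, key _ ⟨(-n, -1), false⟩ ⟨(-n - 1, -1), true⟩ ?_ ?_ ?_ ?_, ?_⟩ <;>
    simp [proj, unit, Edge.ends, Edge.isSideOf_iff, Triangle.side, lower_mem_hexagon,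
        upper_mem_hexagon] <;> omega
  · refine ⟨⟨(-1, -n), 0⟩, key _ ⟨(-1, -n), true⟩ ⟨(-1, -n - 1), false⟩ ?_ ?_ ?_ ?_, ?_⟩ <;>
    simp [proj, unit, Edge.ends, Edge.isSideOf_iff, Triangle.side, lower_mem_hexagon,
        upper_mem_hexagon] <;> omega
  · refine ⟨⟨(n, n - 1), 1⟩, key _ ⟨(n - 1, n - 1), true⟩ ⟨(n, n - 1), false⟩ ?_ ?_ ?_ ?_, ?_⟩ <;>
    simp [proj, unit, Edge.ends, Edge.isSideOf_iff, Triangle.side, lower_mem_hexagon,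
        upper_mem_hexagon] <;> omega

/-- Dually, this corner lies below every cube of the hexagon whose `i`-th coordinate is at least
`n`. -/
theorem opposite_corner_mem_liftedBoundary {n : ℕ} (hn : 1 ≤ n) (i : Fin 3) :
    (fun k => if k = i then (n : ℤ) else 0) ∈ liftedBoundary n 0 := by
  refine ⟨?_, ?_, fun k => by dsimp only; split_ifs <;> omega⟩
  · have key : ∀ e : Edge, ∀ t t' : Triangle, t ∈ hexagon n → e.IsSideOf t → t' ∉ hexagon n →
        e.IsSideOf t' → e ∈ (hexagon n).boundary :=
      fun e t t' h1 h2 h3 h4 => ⟨⟨t, h1, h2⟩, t', h3, h4⟩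
    fin_cases i
    · refine ⟨⟨(n, 0), 1⟩, key _ ⟨(n - 1, 0), true⟩ ⟨(n, 0), false⟩ ?_ ?_ ?_ ?_, ?_⟩ <;>
      simp [proj, unit, Edge.ends, Edge.isSideOf_iff, Triangle.side, lower_mem_hexagon,
        upper_mem_hexagon] <;> omega
    · refine ⟨⟨(0, n), 0⟩, key _ ⟨(0, n - 1), false⟩ ⟨(0, n), true⟩ ?_ ?_ ?_ ?_, ?_⟩ <;>
      simp [proj, unit, Edge.ends, Edge.isSideOf_iff, Triangle.side, lower_mem_hexagon,
        upper_mem_hexagon] <;> omega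
    · refine ⟨⟨(-n, -n), 0⟩, key _ ⟨(-n, -n), true⟩ ⟨(-n, -n - 1), false⟩ ?_ ?_ ?_ ?_, ?_⟩ <;>
      simp [proj, unit, Edge.ends, Edge.isSideOf_iff, Triangle.side, lower_mem_hexagon,
        upper_mem_hexagon] <;> omega
  · obtain ⟨j, hj⟩ := exists_ne i
    exact ⟨j, by simp [hj]⟩

/-! ## Bounds on separating dicuts -/

theorem unit_apply (d i : Fin 3) : unit d i = if i = d then 1 else 0 := by
  simp [unit, Pi.single_apply]

/-- The bottom part of a dicut contains every cube below one of its cubes: one can ascend inside the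
hexagon by always raising a smallest coordinate among those that still have to grow. -/
theorem mem_of_le {n : ℕ} (hn : 1 ≤ n) {X₁ X₂ : Set Edge} {D : Set Cube}
    (hD : ∀ c c', Arc (hexagon n) X₁ X₂ c c' → c' ∈ D → c ∈ D) {c c' : Cube}
    (hc : c ∈ (hexagon n).cubes) (hc' : c' ∈ (hexagon n).cubes) (h : c ≤ c') (hcD : c' ∈ D) :
    c ∈ D := by
  obtain ⟨m, hm⟩ : ∃ m : ℕ, ∑ i, (c' i - c i) = m :=
    ⟨(∑ i, (c' i - c i)).toNat, (Int.toNat_of_nonneg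
      (Finset.sum_nonneg fun i _ => sub_nonneg.2 (h i))).symm⟩
  induction m generalizing c with
  | zero =>
    have : c = c' := by
      ext i
      have := (Finset.sum_eq_zero_iff_of_nonneg (fun i _ => sub_nonneg.2 (h i))).1
        (by simpa using hm) i (Finset.mem_univ i)
      omega
    rwa [this]
  | succ m ih =>
    obtain ⟨d, hd, hmin⟩ : ∃ d, c d < c' d ∧ ∀ k, c k < c' k → c d ≤ c k := by
      have hne : (Finset.univ.filter fun d => c d < c' d).Nonempty := by
        by_contra hcon
        simp only [Finset.not_nonempty_iff_eq_empty, Finset.filter_eq_empty_iff] at hcon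
        have : ∑ i, (c' i - c i) ≤ 0 :=
          Finset.sum_nonpos fun i _ => by have := @hcon i (Finset.mem_univ i); omega
        omega
      obtain ⟨d, hd, hd'⟩ := Finset.exists_min_image _ c hne
      simp only [Finset.mem_filter, Finset.mem_univ, true_and] at hd hd'
      exact ⟨d, hd, hd'⟩
    have hmem : c + unit d ∈ (hexagon n).cubes := by
      rw [mem_cubes hn] at *
      intro i j
      have hij := hc i j
      have hij' := hc' i j
      have hi : c i ≤ c' i := h i
      have hj : c j ≤ c' j := h j
      have mi := hmin i
      have mj := hmin j
      simp only [Pi.add_apply, unit_apply]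
      -- The only critical case is `i = d ≠ j`. If coordinate `j` still has to grow, minimality
      -- gives `c d ≤ c j`, and the new difference is at most 1. Otherwise `c j = c' j`, and the
      -- difference is bounded by that of `c'`.
      split_ifs with h1 h2 h2
      · subst h1; subst h2; omega
      · subst h1; omega
      · omega
      · omega
    have harc : Arc (hexagon n) X₁ X₂ c (c + unit d) :=
      .ascending c d ((proj_edge_mem_edges hn c d).2 ⟨hc, hmem⟩)
    refine hD _ _ harc (ih hmem ?_ ?_)
    · intro i
      have : c i ≤ c' i := h i
      simp only [Pi.add_apply, unit_apply]
      split_ifs with h1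
      · subst h1; omega
      · omega
    · have : ∑ i, (c' i - (c + unit d) i) = ∑ i, (c' i - c i) - 1 := by
        simp only [Pi.add_apply, ← sub_sub, Finset.sum_sub_distrib]
        simp [unit_apply]
      rw [this, hm]
      push_cast
      ring

theorem emptyCut_subset {n : ℕ} (hn : 1 ≤ n) {X₂ : Set Edge} {D : Set Cube}
    (hD : D ∈ separatingDicuts n X₂) : emptyCut n ⊆ D := by
  obtain ⟨⟨_, _, _, hD⟩, hbot, _⟩ := hD
  rintro c ⟨hc, i, hi⟩
  have hcor := corner_mem_liftedBoundary hn i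
  refine mem_of_le hn hD hc (liftedBoundary_subset_cubes _ _ hcor) ?_ (hbot hcor)
  intro k
  have := (mem_cubes hn c).1 hc k i
  dsimp only
  split_ifs with h
  · subst h; omega
  · omega

theorem subset_fullCut {n : ℕ} (hn : 1 ≤ n) {X₂ : Set Edge} {D : Set Cube}
    (hD : D ∈ separatingDicuts n X₂) : D ⊆ fullCut n := by
  obtain ⟨⟨hDc, _, _, hD⟩, _, htop⟩ := hD
  refine fun c hc => ⟨hDc hc, fun i => ?_⟩
  by_contra! hi
  have hcor := opposite_corner_mem_liftedBoundary hn i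
  refine Set.disjoint_left.1 htop hcor
    (mem_of_le hn hD (liftedBoundary_subset_cubes _ _ hcor) (hDc hc) ?_ hc)
  intro k
  have := (mem_cubes hn c).1 (hDc hc) i k
  dsimp only
  split_ifs with h
  · subst h; omega
  · omega

/-! ### The extreme cuts and the boundary of the hexagon -/

theorem liftedBoundary_subset_emptyCut (n : ℕ) : liftedBoundary n (-1) ⊆ emptyCut n := by
  intro c hc
  obtain ⟨i, hi⟩ := hc.2.1
  exact ⟨liftedBoundary_subset_cubes _ _ hc, i, by omega⟩

theorem disjoint_liftedBoundary_fullCut (n : ℕ) : Disjoint (liftedBoundary n 0) (fullCut n) := by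
  refine Set.disjoint_left.2 fun c hc hc' => ?_
  obtain ⟨i, hi⟩ := exists_le_of_mem_liftedBoundary hc
  have := hc'.2 i
  omega

theorem emptyCut_subset_fullCut {n : ℕ} (hn : 1 ≤ n) : emptyCut n ⊆ fullCut n := by
  rintro c ⟨hc, i, hi⟩
  refine ⟨hc, fun j => ?_⟩
  have := (mem_cubes hn c).1 hc j i
  omega

/-- A boundary edge runs along a single side of the hexagon, so the same coordinate difference is
extremal at both ends; if none were, the triangles on both sides of the edge would belong to the
hexagon. -/
theorem sub_eq_of_mem_boundary {n : ℕ} (hn : 1 ≤ n) {c : Cube} {d : Fin 3}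
    (h : ⟨proj c, d⟩ ∈ (hexagon n).boundary) :
    ∃ i j, c i - c j = n ∧ (c + unit d) i - (c + unit d) j = n := by
  have hc := (mem_cubes hn c).1 (mem_cubes_of_mem_boundary h (by simp [Edge.ends]))
  have hc' := (mem_cubes hn (c + unit d)).1
    (mem_cubes_of_mem_boundary h (by simp [Edge.ends, proj_add]))
  obtain ⟨-, t, ht, hs⟩ := h
  by_contra! hcon
  apply ht
  obtain ⟨⟨a, b⟩, l⟩ := t
  rw [Edge.isSideOf_iff] at hs
  simp only [Fin.forall_fin_succ, Pi.add_apply, unit_apply] at hc hc' hcon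
  cases l <;> simp only [lower_mem_hexagon, upper_mem_hexagon] <;> fin_cases d <;>
    simp [Triangle.side, proj] at hs hc hc' hcon <;> omega

theorem separating_of_between {n : ℕ} (hn : 1 ≤ n) {X₂ : Set Edge} {D : Set Cube}
    (h0 : emptyCut n ⊆ D) (h1 : D ⊆ fullCut n)
    (hD : ∀ c c', Arc (hexagon n) ∅ X₂ c c' → c' ∈ D → c ∈ D) : D ∈ separatingDicuts n X₂ := by
  have hbot := liftedBoundary_subset_emptyCut n
  have htop := disjoint_liftedBoundary_fullCut n
  have hcor := opposite_corner_mem_liftedBoundary hn 0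
  refine ⟨⟨h1.trans fun c hc => hc.1, ⟨_, h0 (hbot (corner_mem_liftedBoundary hn 0))⟩,
    ⟨_, liftedBoundary_subset_cubes _ _ hcor, fun h => Set.disjoint_left.1 htop hcor (h1 h)⟩, hD⟩,
    hbot.trans h0, htop.mono_right h1⟩

/-- The difference of coordinates `i` and `j` is `n` at both ends, so `d` is neither `i` nor `j`.
Coordinate `j` is a smallest one, hence negative, and it does not change. -/
theorem mem_emptyCut_of_boundary {n : ℕ} (hn : 1 ≤ n) {c : Cube} {d : Fin 3}
    (h : ⟨proj c, d⟩ ∈ (hexagon n).boundary) (hc : c ∈ emptyCut n) : c + unit d ∈ emptyCut n := by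
  have hc' : c + unit d ∈ (hexagon n).cubes :=
    mem_cubes_of_mem_boundary h (by simp [Edge.ends, proj_add])
  refine ⟨hc', ?_⟩
  by_contra! hcon
  obtain ⟨i, j, hij, hij'⟩ := sub_eq_of_mem_boundary hn h
  obtain ⟨hc, k, hk⟩ := hc
  have h1 := (mem_cubes hn c).1 hc i k
  have h2 := hcon j
  have h3 := hcon i
  simp only [Pi.add_apply, unit_apply] at *
  split_ifs at * <;> first | omega | (subst_vars; omega)

/-- Here the unchanged coordinate `i` is a largest one and stays below `n`. -/
theorem mem_fullCut_of_boundary {n : ℕ} (hn : 1 ≤ n) {c : Cube} {d : Fin 3}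
    (h : ⟨proj c, d⟩ ∈ (hexagon n).boundary) (hc : c ∈ fullCut n) : c + unit d ∈ fullCut n := by
  have hc' : c + unit d ∈ (hexagon n).cubes :=
    mem_cubes_of_mem_boundary h (by simp [Edge.ends, proj_add])
  refine ⟨hc', ?_⟩
  by_contra! hcon
  obtain ⟨i, j, hij, hij'⟩ := sub_eq_of_mem_boundary hn h
  obtain ⟨k, hk⟩ := hcon
  have h1 := (mem_cubes hn _).1 hc' k j
  have h2 := hc.2 i
  have h3 := hc.2 k
  simp only [Pi.add_apply, unit_apply] at *
  split_ifs at * <;> first | omega | (subst_vars; omega)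

theorem emptyCut_closed {n : ℕ} (hn : 1 ≤ n) (c c' : Cube) (h : Arc (hexagon n) ∅ ∅ c c')
    (hc' : c' ∈ emptyCut n) : c ∈ emptyCut n := by
  cases h with
  | ascending _ d h =>
    refine ⟨((proj_edge_mem_edges hn c d).1 h).1, ?_⟩
    obtain ⟨i, hi⟩ := hc'.2
    refine ⟨i, ?_⟩
    simp only [Pi.add_apply, unit_apply] at hi
    split_ifs at hi <;> omega
  | descending _ d h => exact mem_emptyCut_of_boundary hn (by simpa using h) hc'
  | lateral c d i j h => exact h.elim

theorem fullCut_closed {n : ℕ} (hn : 1 ≤ n) (c c' : Cube) (h : Arc (hexagon n) ∅ ∅ c c')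
    (hc' : c' ∈ fullCut n) : c ∈ fullCut n := by
  cases h with
  | ascending _ d h =>
    refine ⟨((proj_edge_mem_edges hn c d).1 h).1, fun i => ?_⟩
    have hi := hc'.2 i
    simp only [Pi.add_apply, unit_apply] at hi
    split_ifs at hi <;> omega
  | descending _ d h => exact mem_fullCut_of_boundary hn (by simpa using h) hc'
  | lateral c d i j h => exact h.elim

/-- The empty cube is the smallest and the full cube the largest unconstrained cut. -/
theorem isLeast_emptyCut_and_isGreatest_fullCut {n : ℕ} (hn : 1 ≤ n) :
    IsLeast (separatingDicuts n ∅) (emptyCut n) ∧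
      IsGreatest (separatingDicuts n ∅) (fullCut n) :=
  ⟨⟨separating_of_between hn subset_rfl (emptyCut_subset_fullCut hn) (emptyCut_closed hn),
      fun _ hD => emptyCut_subset hn hD⟩,
    separating_of_between hn (emptyCut_subset_fullCut hn) subset_rfl (fullCut_closed hn),
      fun _ hD => subset_fullCut hn hD⟩

/-! ## Height functions -/

/-- The cubes of the hexagon whose last coordinate is at most the height of their projection. -/
def below (n : ℕ) (h : Vertex → ℤ) : Set Cube := {c ∈ (hexagon n).cubes | c 2 ≤ h (proj c)}

/-- The amount by which the height function fails to rise with an ascending arc over the edge. -/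
def gap (h : Vertex → ℤ) (e : Edge) : ℤ :=
  h e.base + unit e.dir 2 - h (e.base + proj (unit e.dir))

/-- The edges over which the surface of the height function jumps, as diagonals of lozenges. -/
def surface (n : ℕ) (h : Vertex → ℤ) : Set Lozenge :=
  {L | L.diagonal ∈ (hexagon n).edges ∧ gap h L.diagonal = 1}

/-- The three positively directed sides form a closed cycle, so the heights cancel; the remaining 1
is the third coordinate gained by the step in direction 2. -/
theorem sum_gap (h : Vertex → ℤ) (t : Triangle) : ∑ d, gap h (t.side d) = 1 := by
  obtain ⟨⟨a, b⟩, l⟩ := t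
  cases l <;>
    simp [Fin.sum_univ_three, gap, Triangle.side, proj_unit_zero, proj_unit_one, proj_unit_two,
      unit_apply] <;> ring

theorem univ_eq_of_ne {d i j : Fin 3} (hi : i ≠ d) (hj : j ≠ d) (hij : i ≠ j) :
    (Finset.univ : Finset (Fin 3)) = {d, i, j} := by
  revert d i j; decide

theorem sum_eq_of_ne {d i j : Fin 3} (hi : i ≠ d) (hj : j ≠ d) (hij : i ≠ j) (f : Fin 3 → ℤ) :
    ∑ k, f k = f d + f i + f j := by
  rw [univ_eq_of_ne hi hj hij, Finset.sum_insert, Finset.sum_insert, Finset.sum_singleton,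
    add_assoc]
  · simpa using hij
  · simp [hi.symm, hj.symm]

theorem exists_proj_eq (v : Vertex) (k : ℤ) : ∃ c : Cube, proj c = v ∧ c 2 = k :=
  ⟨![v.1 + k, v.2 + k, k], by simp [proj], rfl⟩

/-- On a fibre of the projection, the cubes of `D` are downward closed by `mem_of_le` and bounded
above by `fullCut`; the height is the third coordinate of the topmost one. -/
theorem exists_height {n : ℕ} (hn : 1 ≤ n) {X₂ : Set Edge} {D : Set Cube}
    (hD : D ∈ separatingDicuts n X₂) : ∃ h, D = below n h := by
  have h0 := emptyCut_subset hn hD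
  have h1 := subset_fullCut hn hD
  have key : ∀ v : Vertex, ∃ k : ℤ, ∀ c ∈ (hexagon n).cubes, proj c = v → (c ∈ D ↔ c 2 ≤ k) := by
    intro v
    by_cases hv : ∃ c ∈ D, proj c = v
    · obtain ⟨c₀, hc₀, rfl⟩ := hv
      obtain ⟨k, ⟨c, hc, hck, rfl⟩, hmax⟩ := Int.exists_greatest_of_bdd
        (P := fun k => ∃ c ∈ D, proj c = proj c₀ ∧ c 2 = k)
        ⟨n, fun k ⟨c, hc, _, hck⟩ => hck ▸ ((h1 hc).2 2).le⟩ ⟨_, c₀, hc₀, rfl, rfl⟩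
      refine ⟨c 2, fun c' hc' hp => ⟨fun h => hmax _ ⟨c', h, hp, rfl⟩, fun h => ?_⟩⟩
      refine mem_of_le hn hD.1.2.2.2 hc' (h1 hc).1 ?_ hc
      rw [← hp] at hck
      simp only [proj, Prod.mk.injEq] at hck
      intro i
      fin_cases i <;> simp <;> omega
    · push Not at hv
      -- Default for a fibre without cubes of `D`. Any negative value works: a hexagon cube at or
      -- below it would lie in `emptyCut`, hence in `D`.
      refine ⟨-n - 1, fun c hc hp =>
        ⟨fun h => (hv c h hp).elim, fun h => (hv c (h0 ⟨hc, 2, ?_⟩) hp).elim⟩⟩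
      omega
  choose h hh using key
  refine ⟨h, Set.ext fun c => ⟨fun hc => ⟨(h1 hc).1, ?_⟩, fun hc => ?_⟩⟩
  · exact (hh _ c (h1 hc).1 rfl).1 hc
  · exact (hh _ c hc.1 rfl).2 hc.2

/-! ### Closure under arcs as conditions on gaps -/

section Conditions

variable {n : ℕ} {X₂ : Set Edge} {h : Vertex → ℤ}

/-- Apply closure to the ascending arc whose head is the topmost bottom cube of its fibre. -/
theorem gap_nonneg_of_closed (hn : 1 ≤ n)
    (hD : ∀ c c', Arc (hexagon n) ∅ X₂ c c' → c' ∈ below n h → c ∈ below n h)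
    {e : Edge} (he : e ∈ (hexagon n).edges) : 0 ≤ gap h e := by
  obtain ⟨v, d⟩ := e
  obtain ⟨c, rfl, hc⟩ := exists_proj_eq v (h (v + proj (unit d)) - unit d 2)
  have := (hD _ _ (.ascending c d he) ⟨((proj_edge_mem_edges hn c d).1 he).2, by
    rw [proj_add, Pi.add_apply, hc]; omega⟩).2
  simp only [gap]
  omega

/-- The descending arc into the topmost bottom cube over the base gives the inequality opposite to
`gap_nonneg_of_closed`. -/
theorem gap_eq_zero_of_closed (hn : 1 ≤ n)
    (hD : ∀ c c', Arc (hexagon n) ∅ X₂ c c' → c' ∈ below n h → c ∈ below n h)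
    {e : Edge} (he : e ∈ (hexagon n).edges) (he' : e ∈ (hexagon n).boundary ∪ X₂) :
    gap h e = 0 := by
  have h0 := gap_nonneg_of_closed hn hD he
  obtain ⟨v, d⟩ := e
  obtain ⟨c, rfl, hc⟩ := exists_proj_eq v (h v)
  have := (hD _ _ (.descending c d (by simpa using he'))
    ⟨((proj_edge_mem_edges hn c d).1 he).1, hc.le⟩).2
  rw [proj_add, Pi.add_apply, hc] at this
  simp only [gap] at *
  omega

/-- Both edges end at `v`, so the height at `v` cancels and the inequality is closure under one
lateral arc. Exchanging `i` and `j` gives equality. -/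
theorem gap_le_gap_of_closed (hn : 1 ≤ n)
    (hD : ∀ c c', Arc (hexagon n) ∅ X₂ c c' → c' ∈ below n h → c ∈ below n h)
    {v : Vertex} {d i j : Fin 3} (he : ⟨v, d⟩ ∈ X₂) (he' : ⟨v, d⟩ ∈ (hexagon n).interiorEdges)
    (hi : i ≠ d) (hj : j ≠ d) (hij : i ≠ j) :
    gap h ⟨v - proj (unit j), j⟩ ≤ gap h ⟨v - proj (unit i), i⟩ := by
  obtain ⟨t, ht, hti, -⟩ := exists_triangle v hj hi hij.symm
  obtain ⟨c, rfl, hc⟩ := exists_proj_eq v (h (v - proj (unit j)) + unit j 2)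
  have hmem : c - unit j ∈ (hexagon n).cubes := by
    have : (⟨proj (c - unit j), j⟩ : Edge) ∈ (hexagon n).edges :=
      ⟨t, he' t (ht ▸ t.side_isSideOf d), by rw [proj_sub, ← hti]; exact t.side_isSideOf j⟩
    exact ((proj_edge_mem_edges hn _ _).1 this).1
  have := (hD _ _ (.lateral c d i j he hi hj hij) ⟨hmem, by
    rw [proj_sub, Pi.sub_apply, hc]; omega⟩).2
  rw [proj_sub, Pi.sub_apply, hc] at this
  simp only [gap, sub_add_cancel]
  omega

theorem gap_nonneg_triangle {t : Triangle} (hh : ∀ d, 0 ≤ gap h (t.side d)) :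
    ∃! d, gap h (t.side d) = 1 := by
  have hs := sum_gap h t
  rw [Fin.sum_univ_three] at hs
  have h0 := hh 0
  have h1 := hh 1
  have h2 := hh 2
  have : gap h (t.side 0) = 1 ∨ gap h (t.side 1) = 1 ∨ gap h (t.side 2) = 1 := by omega
  rcases this with h | h | h
  · refine ⟨0, h, fun d hd => ?_⟩
    fin_cases d <;> simp at hd ⊢ <;> omega
  · refine ⟨1, h, fun d hd => ?_⟩
    fin_cases d <;> simp at hd ⊢ <;> omega
  · refine ⟨2, h, fun d hd => ?_⟩
    fin_cases d <;> simp at hd ⊢ <;> omega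

/-- Dicuts that separate the lifted boundary cycles give solutions. -/
theorem isSolution_surface (hn : 1 ≤ n) (hX : X₂ ⊆ (hexagon n).interiorEdges)
    (hD : ∀ c c', Arc (hexagon n) ∅ X₂ c c' → c' ∈ below n h → c ∈ below n h) :
    IsSolution (hexagon n) ∅ X₂ (surface n h) := by
  have hcov : ∀ t ∈ hexagon n, ∃! L, L ∈ surface n h ∧ L.Covers t := by
    intro t ht
    obtain ⟨d, hd, huniq⟩ := gap_nonneg_triangle fun d =>
      gap_nonneg_of_closed hn hD (e := t.side d) ⟨t, ht, t.side_isSideOf d⟩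
    refine ⟨⟨t.side d⟩, ⟨⟨⟨t, ht, t.side_isSideOf d⟩, hd⟩, t.side_isSideOf d⟩, ?_⟩
    rintro ⟨e⟩ ⟨⟨he, hgap⟩, hc⟩
    have hc : e = t.side e.dir := (Edge.isSideOf_iff _ _).1 hc
    have hgap : gap h e = 1 := hgap
    rw [hc] at hgap
    rw [hc, huniq _ hgap]
  have hX0 : ∀ e ∈ X₂, gap h e = 0 := fun e he =>
    gap_eq_zero_of_closed hn hD (mem_edges_of_mem_interiorEdges (hX he)).1 (Or.inr he)
  refine ⟨⟨fun L hL t hLt => ?_, hcov⟩, fun e he L hL hLe => ?_, ?_⟩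
  -- A lozenge that sticks out would have a boundary edge as its diagonal, where the gap is 0.
  · by_contra ht
    have := gap_eq_zero_of_closed hn hD hL.1 (Or.inl ⟨hL.1, t, ht, hLt⟩)
    have := hL.2
    omega
  · have hLe : L.diagonal = e := hLe
    have h1 := hX0 e (by simpa using he)
    have h2 := hL.2
    rw [hLe] at h2
    omega
  · rintro ⟨v, d⟩ he L hL L' hL' hne ⟨hno, t, hLt, het⟩ ⟨hno', t', hLt', het'⟩ hor
    have hI := hX he
    obtain ⟨e⟩ := L
    obtain ⟨e'⟩ := L'
    have hor : e.dir = e'.dir := hor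
    have hno : ¬ e = ⟨v, d⟩ := hno
    have hno' : ¬ e' = ⟨v, d⟩ := hno'
    have hLt : e = t.side e.dir := (Edge.isSideOf_iff _ _).1 hLt
    have hLt' : e' = t'.side e'.dir := (Edge.isSideOf_iff _ _).1 hLt'
    have het0 : t.side d = ⟨v, d⟩ := ((Edge.isSideOf_iff _ _).1 het).symm
    have het0' : t'.side d = ⟨v, d⟩ := ((Edge.isSideOf_iff _ _).1 het').symm
    have hg : gap h e = 1 := hL.2
    have hg' : gap h e' = 1 := hL'.2
    have hne : e ≠ e' := fun h => hne (by rw [h])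
    rw [← hor] at hLt'
    obtain ⟨i, hi⟩ : ∃ i, i = e.dir := ⟨_, rfl⟩
    rw [← hi] at hLt hLt'
    have hid : i ≠ d := by
      rintro rfl
      exact hno (hLt.trans het0)
    obtain ⟨j, hjd, hij⟩ := exists_third hid
    have le1 := gap_le_gap_of_closed hn hD he hI hid hjd hij
    have le2 := gap_le_gap_of_closed hn hD he hI hjd hid hij.symm
    have s1 := sum_gap h t
    have s2 := sum_gap h t'
    rw [sum_eq_of_ne hid hjd hij] at s1 s2
    have z := hX0 _ he
    have n1 := gap_nonneg_of_closed hn hD (e := t.side j) ⟨t, hI t het, t.side_isSideOf j⟩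
    have n2 := gap_nonneg_of_closed hn hD (e := t'.side j) ⟨t', hI t' het', t'.side_isSideOf j⟩
    rw [hLt] at hg hne
    rw [hLt'] at hg' hne
    -- If both triangles lie on the same side of the edge, the diagonals coincide. Otherwise one
    -- diagonal of direction `i` ends at `v`; by `le1` and `le2` the edge of direction `j` ending at
    -- `v` also has gap 1. It is a side of the other triangle, which has a second side of gap 1 in
    -- direction `i`, against the sum 1.
    rcases Triangle.side_cases het0 hid hjd hij with ⟨a, b⟩ | ⟨a, b⟩ <;>
      rcases Triangle.side_cases het0' hid hjd hij with ⟨a', b'⟩ | ⟨a', b'⟩ <;>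
      rw [a, b, het0] at s1 <;> rw [a', b', het0'] at s2
    · exact hne (a.trans a'.symm)
    · rw [a] at hg; rw [b'] at hg'; omega
    · rw [b] at hg; rw [a'] at hg'; omega
    · exact hne (b.trans b'.symm)

theorem mem_surface_iff (hn : 1 ≤ n)
    (hD : ∀ c c', Arc (hexagon n) ∅ X₂ c c' → c' ∈ below n h → c ∈ below n h) (L : Lozenge) :
    L ∈ surface n h ↔ ∃ c ∈ below n h, proj c = L.diagonal.base ∧
      c + unit L.diagonal.dir ∈ (hexagon n).cubes \ below n h := by
  obtain ⟨v, d⟩ := L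
  constructor
  · rintro ⟨he, hg⟩
    obtain ⟨c, rfl, hc⟩ := exists_proj_eq v (h v)
    have hcc := (proj_edge_mem_edges hn c d).1 he
    refine ⟨c, ⟨hcc.1, hc.le⟩, rfl, hcc.2, fun hb => ?_⟩
    have := hb.2
    rw [proj_add, Pi.add_apply] at this
    simp only [gap] at hg
    dsimp only at this
    omega
  · rintro ⟨c, hc, rfl, hc', hb⟩
    have he : (⟨proj c, d⟩ : Edge) ∈ (hexagon n).edges :=
      (proj_edge_mem_edges hn c d).2 ⟨hc.1, hc'⟩
    refine ⟨he, ?_⟩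
    have h1 : 1 ≤ gap h ⟨proj c, d⟩ := by
      by_contra! hg
      refine hb ⟨hc', ?_⟩
      have := hc.2
      rw [proj_add, Pi.add_apply]
      simp only [gap] at hg ⊢
      omega
    -- The gap is also at most 1, as one of three nonnegative gaps with sum 1.
    obtain ⟨t, ht, het⟩ := he
    rw [Edge.isSideOf_iff] at het
    have hs := sum_gap h t
    have hnn := fun k => gap_nonneg_of_closed hn hD (e := t.side k) ⟨t, ht, t.side_isSideOf k⟩
    have := Finset.single_le_sum (f := fun k => gap h (t.side k)) (fun k _ => hnn k)
      (Finset.mem_univ d)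
    dsimp only at this het ⊢
    rw [← het] at this
    omega

end Conditions

/-! ## The height function of a tiling -/

/-- The height function of the empty cube. -/
def baseHeight (v : Vertex) : ℤ := -1 - min (min v.1 v.2) 0

open Classical in
/-- The indicator function of the diagonals of a set of lozenges. -/
noncomputable def diagonalIndicator (T : Set Lozenge) (e : Edge) : ℤ := if ⟨e⟩ ∈ T then 1 else 0

open Classical in
/-- The difference of the gaps of the empty cube and of the tiling, zero outside the hexagon. -/
noncomputable def gapDiff (n : ℕ) (T : Set Lozenge) (e : Edge) : ℤ :=
  if e ∈ (hexagon n).edges then gap baseHeight e - diagonalIndicator T e else 0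

/-- The difference of the height functions of the tiling and of the empty cube: the sum of the
differences of the gaps from the left. -/
noncomputable def heightDiff (n : ℕ) (T : Set Lozenge) (v : Vertex) : ℤ :=
  ∑ i ∈ Finset.range (v.1 + n).toNat, gapDiff n T ⟨(-n + i, v.2), 0⟩

/-- The height function of a tiling. -/
noncomputable def tilingHeight (n : ℕ) (T : Set Lozenge) (v : Vertex) : ℤ :=
  baseHeight v + heightDiff n T v

section

variable {n : ℕ} {T : Set Lozenge}

theorem sum_diagonalIndicator (hT : IsTiling (hexagon n) T) {t : Triangle} (ht : t ∈ hexagon n) :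
    ∑ d, diagonalIndicator T (t.side d) = 1 := by
  obtain ⟨⟨e⟩, ⟨hL, hc⟩, huniq⟩ := hT.2 t ht
  have hc : e = t.side e.dir := (Edge.isSideOf_iff _ _).1 hc
  rw [Finset.sum_eq_single e.dir]
  · rw [← hc, diagonalIndicator, if_pos hL]
  · intro d _ hd
    rw [diagonalIndicator, if_neg]
    intro h
    have := huniq ⟨t.side d⟩ ⟨h, t.side_isSideOf d⟩
    rw [Lozenge.mk.injEq] at this
    exact hd (by rw [← this, Triangle.side_dir])
  · simp

theorem gap_baseHeight_of_boundary (hn : 1 ≤ n) {e : Edge} (he : e ∈ (hexagon n).boundary) :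
    gap baseHeight e = 0 := by
  obtain ⟨v, d⟩ := e
  have hv := not_lt_of_mem_boundary he (v := v) (by simp [Edge.ends])
  have hv' := not_lt_of_mem_boundary he (v := v + proj (unit d)) (by simp [Edge.ends])
  obtain ⟨h1, h2⟩ := (mem_hexagon_edges _).1 (show _ ∈ (hexagon n).edges from he.1)
  obtain ⟨_, t, ht, het⟩ := he
  obtain ⟨⟨a, b⟩, l⟩ := t
  rw [Edge.isSideOf_iff] at het
  obtain ⟨p, q⟩ := v
  simp only [abs_lt, abs_le] at *
  cases l <;> simp only [lower_mem_hexagon, upper_mem_hexagon] at ht <;> fin_cases d <;>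
    simp [Triangle.side, gap, baseHeight, unit_apply, proj_unit_zero, proj_unit_one,
      proj_unit_two] at * <;> omega

/-- On a boundary edge neither the surface of the empty cube nor the tiling has a diagonal; other
edges of an outer triangle get 0 by definition. Thus `gapDiff` extends by zero to the whole grid. -/
theorem gapDiff_eq_zero (hn : 1 ≤ n) (hT : IsTiling (hexagon n) T) {t : Triangle}
    (ht : t ∉ hexagon n) {e : Edge} (he : e.IsSideOf t) : gapDiff n T e = 0 := by
  rw [gapDiff]
  split_ifs with h
  · rw [gap_baseHeight_of_boundary hn ⟨h, t, ht, he⟩, diagonalIndicator, if_neg, sub_zero]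
    exact fun hL => ht (hT.1 _ hL t he)
  · rfl

/-- This closedness around triangles makes the integral `heightDiff` independent of the path; inside
the hexagon it is the difference of two sums equal to 1. -/
theorem sum_gapDiff (hn : 1 ≤ n) (hT : IsTiling (hexagon n) T) (t : Triangle) :
    ∑ d, gapDiff n T (t.side d) = 0 := by
  by_cases ht : t ∈ hexagon n
  · have : ∀ d, gapDiff n T (t.side d) =
        gap baseHeight (t.side d) - diagonalIndicator T (t.side d) := fun d =>
      if_pos ⟨t, ht, t.side_isSideOf d⟩
    simp only [this, Finset.sum_sub_distrib, sum_gap, sum_diagonalIndicator hT ht, sub_self]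
  · exact Finset.sum_eq_zero fun d _ => gapDiff_eq_zero hn hT ht (t.side_isSideOf d)

theorem heightDiff_right (hn : 1 ≤ n) (hT : IsTiling (hexagon n) T) (a b : ℤ) :
    heightDiff n T (a + 1, b) = heightDiff n T (a, b) + gapDiff n T ⟨(a, b), 0⟩ := by
  by_cases ha : -(n : ℤ) ≤ a
  · have h1 : (a + 1 + n).toNat = (a + n).toNat + 1 := by omega
    have h2 : -(n : ℤ) + ((a + n).toNat : ℤ) = a := by omega
    simp only [heightDiff, h1, Finset.sum_range_succ, h2]
  -- Left of the hexagon `toNat` truncates both sums to the empty sum, and the edge lies outside.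
  · have h1 : (a + 1 + n).toNat = 0 := by omega
    have h2 : (a + n).toNat = 0 := by omega
    rw [gapDiff_eq_zero hn hT (t := ⟨(a, b), true⟩)]
    · simp [heightDiff, h1, h2]
    · rw [lower_mem_hexagon]; omega
    · simp [Edge.isSideOf_iff, Triangle.side]

theorem heightDiff_up (hn : 1 ≤ n) (hT : IsTiling (hexagon n) T) (a b : ℤ) :
    heightDiff n T (a, b + 1) = heightDiff n T (a, b) + gapDiff n T ⟨(a, b), 1⟩ := by
  by_cases ha : -(n : ℤ) ≤ a
  · induction a, ha using Int.leInduction with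
    | base =>
      rw [gapDiff_eq_zero hn hT (t := ⟨(-n - 1, b), true⟩)]
      · simp [heightDiff]
      · rw [lower_mem_hexagon]; omega
      · simp [Edge.isSideOf_iff, Triangle.side]
    | succ a ha ih =>
      rw [heightDiff_right hn hT, heightDiff_right hn hT, ih]
      -- The two triangles of a unit square share the diagonal, so subtracting their sums equates
      -- the two paths across the square.
      have h1 := sum_gapDiff hn hT ⟨(a, b), true⟩
      have h2 := sum_gapDiff hn hT ⟨(a, b), false⟩
      simp [Fin.sum_univ_three, Triangle.side] at h1 h2
      linarith
  · have h1 : (a + n).toNat = 0 := by omega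
    rw [gapDiff_eq_zero hn hT (t := ⟨(a, b), false⟩)]
    · simp [heightDiff, h1]
    · rw [upper_mem_hexagon]; omega
    · simp [Edge.isSideOf_iff, Triangle.side]

theorem heightDiff_end (hn : 1 ≤ n) (hT : IsTiling (hexagon n) T) (e : Edge) :
    heightDiff n T (e.base + proj (unit e.dir)) = heightDiff n T e.base + gapDiff n T e := by
  obtain ⟨⟨a, b⟩, d⟩ := e
  fin_cases d
  · simpa [proj_unit_zero] using heightDiff_right hn hT a b
  · simpa [proj_unit_one] using heightDiff_up hn hT a b
  · have h1 := sum_gapDiff hn hT ⟨(a - 1, b - 1), true⟩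
    have h2 := heightDiff_right hn hT (a - 1) (b - 1)
    have h3 := heightDiff_up hn hT a (b - 1)
    simp [Fin.sum_univ_three, Triangle.side, proj_unit_two, ← sub_eq_add_neg] at *
    linarith

theorem gap_tilingHeight (hn : 1 ≤ n) (hT : IsTiling (hexagon n) T) {e : Edge}
    (he : e ∈ (hexagon n).edges) : gap (tilingHeight n T) e = diagonalIndicator T e := by
  have h := heightDiff_end hn hT e
  rw [gapDiff, if_pos he] at h
  simp only [gap, tilingHeight, h]
  ring

/-- Every such vertex is reached by a path of edges adjacent to triangles outside the hexagon: from
the left along its row, or, on the right-hand side, from below along its column. -/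
theorem heightDiff_eq_zero (hn : 1 ≤ n) (hT : IsTiling (hexagon n) T) (a b : ℤ)
    (h : ¬ (|a| < (n : ℤ) ∧ |b| < (n : ℤ) ∧ |a - b| < (n : ℤ))) : heightDiff n T (a, b) = 0 := by
  have row : ∀ b a : ℤ, (n ≤ b ∨ b ≤ -n ∨ n ≤ b - a ∨ a ≤ -n) → heightDiff n T (a, b) = 0 := by
    intro b a hab
    refine Finset.sum_eq_zero fun i hi => ?_
    simp only [Finset.mem_range] at hi
    dsimp only
    have hi' : -(n : ℤ) + i < a := by omega
    generalize -(n : ℤ) + i = k at hi'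
    by_cases hb : b ≤ -n
    · rw [gapDiff_eq_zero hn hT (t := ⟨(k, b - 1), false⟩)]
      · rw [upper_mem_hexagon]; omega
      · simp [Edge.isSideOf_iff, Triangle.side]
    · rw [gapDiff_eq_zero hn hT (t := ⟨(k, b), true⟩)]
      · rw [lower_mem_hexagon]; omega
      · simp [Edge.isSideOf_iff, Triangle.side]
  have column : ∀ a b : ℤ, (n ≤ a ∨ n ≤ a - b) → heightDiff n T (a, b) = 0 := by
    intro a b hab
    by_cases hb : b ≤ -n
    · exact row b a (by omega)
    · have hb' : -(n : ℤ) ≤ b := by omega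
      clear hb
      induction b, hb' using Int.leInduction with
      | base => exact row _ a (by omega)
      | succ b hb ih =>
        rw [heightDiff_up hn hT, ih (by omega), zero_add]
        rw [gapDiff_eq_zero hn hT (t := ⟨(a, b), false⟩)]
        · rw [upper_mem_hexagon]; omega
        · simp [Edge.isSideOf_iff, Triangle.side]
  by_cases hab : n ≤ a ∨ n ≤ a - b
  · exact column a b hab
  · refine row b a ?_
    simp only [abs_lt] at h
    omega

theorem heightDiff_of_mem_liftedBoundary (hn : 1 ≤ n) (hT : IsTiling (hexagon n) T) {k : ℤ}
    {c : Cube} (hc : c ∈ liftedBoundary n k) : heightDiff n T (proj c) = 0 := by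
  obtain ⟨⟨e, he, hv⟩, _⟩ := hc
  exact heightDiff_eq_zero hn hT _ _ (not_lt_of_mem_boundary he hv)

/-- Solutions give dicuts that separate the lifted boundary cycles. -/
theorem below_tilingHeight_mem_separatingDicuts (hn : 1 ≤ n) {X₂ : Set Edge}
    (hX : X₂ ⊆ (hexagon n).interiorEdges) (hT : IsSolution (hexagon n) ∅ X₂ T) :
    below n (tilingHeight n T) ∈ separatingDicuts n X₂ := by
  obtain ⟨htil, hno, hdiff⟩ := hT
  have hedge : ∀ e ∈ X₂, e ∈ (hexagon n).edges := fun e he =>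
    (mem_edges_of_mem_interiorEdges (hX he)).1
  -- Suppose that of the edges ending at `v` only the one of direction `j` is a diagonal. In the
  -- triangle beyond the constrained edge, directions `d` and `i` are excluded, so its side of
  -- direction `j` is a diagonal too: two lozenges of orientation `j` meet at the edge.
  have hle : ∀ {v d i j}, ⟨v, d⟩ ∈ X₂ → i ≠ d → j ≠ d → i ≠ j →
      diagonalIndicator T ⟨v - proj (unit j), j⟩ ≤ diagonalIndicator T ⟨v - proj (unit i), i⟩ := by
    intro v d i j he hi hj hij
    by_contra! hlt
    have hjT : ⟨⟨v - proj (unit j), j⟩⟩ ∈ T := by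
      by_contra hcon
      rw [diagonalIndicator, diagonalIndicator, if_neg hcon] at hlt
      split_ifs at hlt <;> omega
    have hiT : ⟨⟨v - proj (unit i), i⟩⟩ ∉ T := by
      intro hcon
      rw [diagonalIndicator, diagonalIndicator, if_pos hcon] at hlt
      split_ifs at hlt <;> omega
    obtain ⟨t, htd, hti, htj⟩ := exists_triangle v hi hj hij
    obtain ⟨t', htd', htj', hti'⟩ := exists_triangle v hj hi hij.symm
    have het : (⟨v, d⟩ : Edge).IsSideOf t := htd ▸ t.side_isSideOf d
    have het' : (⟨v, d⟩ : Edge).IsSideOf t' := htd' ▸ t'.side_isSideOf d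
    have hsum := sum_diagonalIndicator htil (hX he t het)
    rw [sum_eq_of_ne hi hj hij, htd, hti, htj, diagonalIndicator, diagonalIndicator,
      diagonalIndicator, if_neg (fun h => hno _ (Or.inr he) _ h rfl), if_neg hiT] at hsum
    have hjT' : ⟨⟨v + proj (unit d), j⟩⟩ ∈ T := by
      by_contra hcon
      rw [if_neg hcon] at hsum
      omega
    have adj : ∀ s : Triangle, s.side d = ⟨v, d⟩ → (Lozenge.mk (s.side j)).IsAdjacentTo ⟨v, d⟩ := by
      intro s hs
      refine ⟨fun h => hj ?_, s, s.side_isSideOf j, hs ▸ s.side_isSideOf d⟩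
      have h : s.side j = ⟨v, d⟩ := h
      rw [← s.side_dir j, h]
    refine hdiff _ he _ hjT _ hjT' ?_ (htj' ▸ adj t' htd') (htj ▸ adj t htd) rfl
    simp only [ne_eq, Lozenge.mk.injEq, Edge.mk.injEq, and_true]
    intro h
    rw [sub_eq_add_neg, add_right_inj] at h
    clear * - h hj
    revert d j
    decide
  have hclosed : ∀ c c', Arc (hexagon n) ∅ X₂ c c' → c' ∈ below n (tilingHeight n T) →
      c ∈ below n (tilingHeight n T) := by
    intro c c' harc hc'
    have ind01 : ∀ e, 0 ≤ diagonalIndicator T e := fun e => by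
      rw [diagonalIndicator]; split_ifs <;> omega
    cases harc with
    | ascending _ d he =>
      refine ⟨((proj_edge_mem_edges hn c d).1 he).1, ?_⟩
      have h1 := hc'.2
      have h2 := gap_tilingHeight hn htil he
      have h3 := ind01 ⟨proj c, d⟩
      simp only [gap] at h2
      rw [proj_add, Pi.add_apply] at h1
      omega
    | descending _ d he =>
      have he' : (⟨proj c', d⟩ : Edge) ∈ (hexagon n).edges := by
        rcases he with (he | he) | he
        · exact he.1
        · exact he.elim
        · exact hedge _ he
      have hz : diagonalIndicator T ⟨proj c', d⟩ = 0 := by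
        rw [diagonalIndicator, if_neg]
        intro hL
        rcases he with (he | he) | he
        · obtain ⟨-, t, ht, het⟩ := he
          exact ht (htil.1 _ hL t het)
        · exact he.elim
        · exact hno _ (Or.inr he) _ hL rfl
      refine ⟨((proj_edge_mem_edges hn _ d).1 he').2, ?_⟩
      have h1 := hc'.2
      have h2 := gap_tilingHeight hn htil he'
      simp only [gap] at h2
      rw [proj_add, Pi.add_apply]
      omega
    | lateral c d i j he hi hj hij =>
      have hmem : ∀ {i j}, i ≠ d → j ≠ d → i ≠ j →
          (⟨proj (c - unit i), i⟩ : Edge) ∈ (hexagon n).edges := by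
        intro i j hi hj hij
        obtain ⟨t, htd, hti, -⟩ := exists_triangle (proj c) hi hj hij
        rw [proj_sub, ← hti]
        exact ⟨t, hX he t (htd ▸ t.side_isSideOf d), t.side_isSideOf i⟩
      have hmi := hmem hi hj hij
      have hmj := hmem hj hi hij.symm
      refine ⟨((proj_edge_mem_edges hn _ _).1 hmi).1, ?_⟩
      have h1 := hc'.2
      have h2 := gap_tilingHeight hn htil hmi
      have h3 := gap_tilingHeight hn htil hmj
      have h4 := hle he hi hj hij
      simp only [gap, proj_sub, sub_add_cancel] at h2 h3
      rw [proj_sub, Pi.sub_apply] at h1 ⊢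
      omega
  have hcor := opposite_corner_mem_liftedBoundary hn 0
  -- On the boundary the height is `baseHeight`, which is the third coordinate of the cube of the
  -- fibre with smallest coordinate -1.
  have hbot : liftedBoundary n (-1) ⊆ below n (tilingHeight n T) := by
    intro c hc
    refine ⟨liftedBoundary_subset_cubes _ _ hc, ?_⟩
    rw [tilingHeight, heightDiff_of_mem_liftedBoundary hn htil hc]
    have h := hc.2.2
    have h0 := h 0
    have h1 := h 1
    have h2 := h 2
    obtain ⟨i, hi⟩ := hc.2.1
    simp only [baseHeight, proj]
    fin_cases i <;> simp at hi <;> omega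
  have htop : Disjoint (liftedBoundary n 0) (below n (tilingHeight n T)) := by
    refine Set.disjoint_left.2 fun c hc hc' => ?_
    have h := hc'.2
    rw [tilingHeight, heightDiff_of_mem_liftedBoundary hn htil hc] at h
    have h0 := hc.2.2 0
    have h1 := hc.2.2 1
    have h2 := hc.2.2 2
    simp only [baseHeight, proj] at h
    omega
  exact ⟨⟨fun c hc => hc.1, ⟨_, hbot (corner_mem_liftedBoundary hn 0)⟩,
    ⟨_, liftedBoundary_subset_cubes _ _ hcor, fun h => Set.disjoint_left.1 htop hcor h⟩, hclosed⟩,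
    hbot, htop⟩

end

/-! ## Total correctness with a time bound -/

/-- The program halts after at most `T` steps in a memory that satisfies `P`. -/
def Runs (W : ℕ) (s : Prog) (σ : Memory) (T : ℕ) (P : Memory → Prop) : Prop :=
  ∃ t σ', Exec W s σ t σ' ∧ t ≤ T ∧ P σ'

namespace Runs

variable {W T T' : ℕ} {s s' : Prog} {σ : Memory} {P Q : Memory → Prop}

theorem mono (h : Runs W s σ T P) (hT : T ≤ T') (hP : ∀ σ', P σ' → Q σ') : Runs W s σ T' Q := by
  obtain ⟨t, σ', he, ht, hσ'⟩ := h
  exact ⟨t, σ', he, ht.trans hT, hP σ' hσ'⟩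

theorem skip (h : P σ) : Runs W .skip σ 1 P := ⟨1, σ, .skip σ, le_rfl, h⟩

theorem assign {r : Reg} {p : Arith} (hp : |p.eval σ| ≤ (W : ℤ)) (h : P (σ.setReg r (p.eval σ))) :
    Runs W (.assign r p) σ (p.cost + 1) P :=
  ⟨_, _, .assign σ r p hp, le_rfl, h⟩

theorem store {a : Arr} {i j l p : Arith} {vi vj vl vp : ℤ} (hi : i.eval σ = vi)
    (hj : j.eval σ = vj) (hl : l.eval σ = vl) (hp : p.eval σ = vp) (bi : |vi| ≤ (W : ℤ))
    (bj : |vj| ≤ (W : ℤ)) (bl : |vl| ≤ (W : ℤ)) (bp : |vp| ≤ (W : ℤ))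
    (h : P (σ.setArr a vi vj vl vp)) :
    Runs W (.store a i j l p) σ (i.cost + j.cost + l.cost + p.cost + 1) P := by
  subst hi hj hl hp
  exact ⟨_, _, .store σ a i j l p bi bj bl bp, le_rfl, h⟩

theorem seq (h : Runs W s σ T fun σ' => Runs W s' σ' T' P) : Runs W (.seq s s') σ (T + T') P := by
  obtain ⟨t, σ', he, ht, t', σ'', he', ht', hP⟩ := h
  exact ⟨t + t', σ'', .seq he he', add_le_add ht ht', hP⟩

theorem ite {b : Cond} (h : b.eval σ = true → Runs W s σ T P)
    (h' : b.eval σ = false → Runs W s' σ T P) : Runs W (.ite b s s') σ (b.cost + 1 + T) P := by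
  cases hb : b.eval σ with
  | true =>
    obtain ⟨t, σ', he, ht, hP⟩ := h hb
    exact ⟨_, σ', .ite_true hb he, by omega, hP⟩
  | false =>
    obtain ⟨t, σ', he, ht, hP⟩ := h' hb
    exact ⟨_, σ', .ite_false hb he, by omega, hP⟩

/-- The rule for loops: an invariant and a potential that decreases. -/
theorem loop {b : Cond} (m : Memory → ℕ)
    (h : ∀ σ, P σ → b.eval σ = true → Runs W s σ T fun σ' => P σ' ∧ m σ' < m σ) (hσ : P σ) :
    Runs W (.loop b s) σ ((b.cost + 1 + T) * m σ + (b.cost + 1))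
      fun σ' => P σ' ∧ b.eval σ' = false := by
  obtain ⟨k, hk⟩ : ∃ k, m σ = k := ⟨_, rfl⟩
  induction k using Nat.strong_induction_on generalizing σ with
  | _ k ih =>
    cases hb : b.eval σ with
    | false => exact ⟨_, σ, .loop_done hb, by omega, hσ, hb⟩
    | true =>
      obtain ⟨t, σ', he, ht, hP, hm⟩ := h σ hσ hb
      obtain ⟨t', σ'', he', ht', hP'⟩ := ih (m σ') (hk ▸ hm) hP rfl
      refine ⟨_, σ'', .loop_step hb he he', ?_, hP'⟩
      have := Nat.mul_le_mul_left (b.cost + 1 + T) (Nat.succ_le_of_lt hm)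
      rw [Nat.mul_succ] at this
      omega

/-- `P k` is the invariant at the loop head with counter `k`. Each of the `n + 1` rounds costs the
body, 4 steps for the test and 4 for the increment; initialisation and the last test cost 6. -/
theorem forEach {r : Reg} {n : ℕ} (P : ℤ → Memory → Prop) (hW : 1 ≤ W) (hn : n ≤ W)
    (hreg : ∀ k σ, P k σ → σ.reg r = k ∧ σ.reg .size = n) (h0 : P (-1) (σ.setReg r (-1)))
    (h : ∀ (k : ℤ) σ, -1 ≤ k → k < n → P k σ →
      Runs W s σ T fun σ' => σ'.reg r = k ∧ P (k + 1) (σ'.setReg r (k + 1))) :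
    Runs W (forEach r s) σ ((T + 8) * (n + 1) + 6) (P n) := by
  refine (seq (T := 2) (T' := (T + 8) * (n + 1) + 4) ?_).mono (by omega)
    fun _ h => h
  refine assign (by simpa [Arith.eval] using hW) ?_
  have hloop := loop (W := W) (s := .seq s (.assign r (.add (.reg r) (.lit 1))))
    (b := .lt (.reg r) (.reg .size)) (T := T + 4)
    (P := fun σ' => ∃ k : ℤ, -1 ≤ k ∧ k ≤ n ∧ P k σ') (σ := σ.setReg r (-1))
    (fun σ' => (n - σ'.reg r).toNat) ?_ ⟨-1, le_rfl, by omega, h0⟩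
  · refine hloop.mono ?_ ?_
    · have : ((n : ℤ) - (σ.setReg r (-1)).reg r).toNat = n + 1 := by
        simp [Memory.setReg]
      simp only [this, Cond.cost, Arith.cost]
      exact le_of_eq (by ring)
    · rintro σ' ⟨⟨k, hk, hk', hP⟩, hb⟩
      obtain ⟨h1, h2⟩ := hreg k σ' hP
      simp only [Cond.eval, Arith.eval, h1, h2, decide_eq_false_iff_not, not_lt] at hb
      rwa [le_antisymm hb hk']
  · rintro σ' ⟨k, hk, hk', hP⟩ hb
    obtain ⟨h1, h2⟩ := hreg k σ' hP
    simp only [Cond.eval, Arith.eval, h1, h2, decide_eq_true_eq] at hb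
    refine seq ((h k σ' hk hb hP).mono le_rfl ?_)
    rintro σ'' ⟨h3, h4⟩
    refine assign ?_ ⟨⟨k + 1, by omega, by omega, ?_⟩, ?_⟩
    · simp only [Arith.eval, h3, abs_le]
      omega
    · simpa [Arith.eval, h3] using h4
    · simp [Memory.setReg, Arith.eval, h3, h1]
      omega

end Runs

/-! ## The state of the algorithm -/

/-- The cube in the registers. -/
def Memory.current (σ : Memory) : Cube := ![σ.reg .x, σ.reg .y, σ.reg .z]

/-- The cube was added to the bottom part. -/
def Memory.IsAdded (σ : Memory) (c : Cube) : Prop := σ.arr .added (c 0) (c 1) (c 2) = 1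

/-- The cube passes the test `inBottom`. -/
def Memory.IsBottom (σ : Memory) (c : Cube) : Prop := (∃ i, c i < 0) ∨ σ.IsAdded c

/-- The cube at a position of the stack. -/
def Memory.stackAt (σ : Memory) (k : ℤ) : Cube :=
  ![σ.arr .stack k 0 0, σ.arr .stack k 1 0, σ.arr .stack k 2 0]

/-- The cube is on the stack. -/
def Memory.OnStack (σ : Memory) (c : Cube) : Prop := ∃ k, 0 ≤ k ∧ k < σ.reg .top ∧ σ.stackAt k = c

/-- The memory after a cube was pushed. -/
def Memory.pushed (σ : Memory) (c : Cube) : Memory :=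
  (((σ.setArr .stack (σ.reg .top) 0 0 (c 0)).setArr .stack (σ.reg .top) 1 0 (c 1)).setArr
    .stack (σ.reg .top) 2 0 (c 2)).setReg .top (σ.reg .top + 1)

/-- The memory after a cube was popped. -/
def Memory.popped (σ : Memory) : Memory :=
  (((σ.setReg .top (σ.reg .top - 1)).setReg .x (σ.arr .stack (σ.reg .top - 1) 0 0)).setReg .y
    (σ.arr .stack (σ.reg .top - 1) 1 0)).setReg .z (σ.arr .stack (σ.reg .top - 1) 2 0)

theorem Cond.eval_lt (σ : Memory) (p q : Arith) :
    (Cond.lt p q).eval σ = true ↔ p.eval σ < q.eval σ := decide_eq_true_iff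

theorem Cond.eval_eq (σ : Memory) (p q : Arith) :
    (Cond.eq p q).eval σ = true ↔ p.eval σ = q.eval σ := decide_eq_true_iff

theorem Cond.eval_not (σ : Memory) (b : Cond) : b.not.eval σ = true ↔ b.eval σ = false := by
  simp [Cond.eval]

theorem Cond.eval_and (σ : Memory) (b b' : Cond) :
    (b.and b').eval σ = true ↔ b.eval σ = true ∧ b'.eval σ = true := by
  simp [Cond.eval]

theorem Cond.eval_or (σ : Memory) (b b' : Cond) :
    (b.or b').eval σ = true ↔ b.eval σ = true ∨ b'.eval σ = true := by
  simp [Cond.eval]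

theorem inBottom_eval (σ : Memory) (v : Cube) :
    (inBottom (shiftX v) (shiftY v) (shiftZ v)).eval σ = true ↔ σ.IsBottom (σ.current + v) := by
  simp only [inBottom, Cond.eval_or, Cond.eval_lt, Cond.eval_eq, Arith.eval, shiftX, shiftY, shiftZ]
  simp [Memory.IsBottom, Memory.IsAdded, Memory.current, Fin.exists_fin_succ, or_assoc]

theorem inTop_eval (σ : Memory) (v : Cube) :
    (inTop (shiftX v) (shiftY v) (shiftZ v)).eval σ = false ↔
      ∀ i, (σ.current + v) i < σ.reg .size := by
  rw [← Bool.not_eq_true, inTop, Cond.eval_not, Bool.not_eq_false]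
  simp only [Cond.eval_and, Cond.eval_lt, Arith.eval, shiftX, shiftY, shiftZ]
  simp [Memory.current, Fin.forall_fin_succ]

theorem constrained_eval (σ : Memory) (d : Fin 3) (v : Cube) :
    (constrained d v).eval σ = true ↔
      σ.arr .constraints (d.val : ℤ) (proj (σ.current + v)).1 (proj (σ.current + v)).2 = 1 := by
  simp only [constrained, Cond.eval_eq, Arith.eval, shiftX, shiftY, shiftZ]
  simp [Memory.current, proj]

/-- The second and third coordinates are evaluated after stack cells were overwritten, so the
expressions are required to depend on the registers only. -/
theorem runs_push {W : ℕ} {σ : Memory} {p q r : Arith} {c : Cube} {P : Memory → Prop}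
    (hp : ∀ σ' : Memory, σ'.reg = σ.reg → p.eval σ' = c 0)
    (hq : ∀ σ' : Memory, σ'.reg = σ.reg → q.eval σ' = c 1)
    (hr : ∀ σ' : Memory, σ'.reg = σ.reg → r.eval σ' = c 2)
    (hc : ∀ i, |c i| ≤ (W : ℤ)) (h0 : 0 ≤ σ.reg .top) (htop : σ.reg .top < W) (hW : 2 ≤ W)
    (h : P (σ.pushed c)) :
    Runs W (push p q r) σ (p.cost + q.cost + r.cost + 17) P := by
  have ht : |σ.reg .top| ≤ (W : ℤ) := by rw [abs_le]; omega
  refine (Runs.seq (T := 1 + 1 + 1 + p.cost + 1) (T' := q.cost + r.cost + 13) ?_).mono (by omega)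
    fun _ h => h
  refine Runs.store (vi := σ.reg .top) (vj := 0) (vl := 0) rfl rfl rfl
    (hp _ rfl) ht ?_ ?_ (hc 0) ?_
  iterate 2 · rw [abs_le]; omega
  refine (Runs.seq (T := 1 + 1 + 1 + q.cost + 1) (T' := r.cost + 9) ?_).mono (by omega)
    fun _ h => h
  refine Runs.store (vi := σ.reg .top) (vj := 1) (vl := 0) rfl rfl rfl
    (hq _ rfl) ht ?_ ?_ (hc 1) ?_
  iterate 2 · rw [abs_le]; omega
  refine (Runs.seq (T := 1 + 1 + 1 + r.cost + 1) (T' := 5) ?_).mono (by omega)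
    fun _ h => h
  refine Runs.store (vi := σ.reg .top) (vj := 2) (vl := 0) rfl rfl rfl
    (hr _ rfl) ht ?_ ?_ (hc 2) ?_
  iterate 2 · rw [abs_le]; omega
  refine Runs.seq (T := 4) (T' := 1) ?_
  refine Runs.assign ?_ (Runs.skip h)
  simp only [Arith.eval, Memory.setArr, abs_le]
  omega

theorem runs_pop {W : ℕ} {σ : Memory} {P : Memory → Prop} (h0 : 0 < σ.reg .top)
    (htop : σ.reg .top ≤ W) (hc : ∀ i, |σ.stackAt (σ.reg .top - 1) i| ≤ (W : ℤ))
    (h : P σ.popped) : Runs W pop σ 20 P := by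
  refine Runs.seq (T := 4) (T' := 16) (Runs.assign ?_ ?_)
  · simp only [Arith.eval, abs_le]; omega
  refine Runs.seq (T := 5) (T' := 11) (Runs.assign (hc 0) ?_)
  refine Runs.seq (T := 5) (T' := 6) (Runs.assign (hc 1) ?_)
  exact Runs.seq (T := 5) (T' := 1) (Runs.assign (hc 2) (Runs.skip h))

theorem pushed_reg {σ : Memory} {c : Cube} {r : Reg} (hr : r ≠ .top) :
    (σ.pushed c).reg r = σ.reg r := by
  simp [Memory.pushed, Memory.setReg, Memory.setArr, hr]

theorem pushed_top {σ : Memory} {c : Cube} : (σ.pushed c).reg .top = σ.reg .top + 1 := by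
  simp [Memory.pushed, Memory.setReg]

theorem pushed_arr {σ : Memory} {c : Cube} {a : Arr} (ha : a ≠ .stack) :
    (σ.pushed c).arr a = σ.arr a := by
  simp [Memory.pushed, Memory.setReg, Memory.setArr, ha]

theorem pushed_stackAt_top (σ : Memory) (c : Cube) : (σ.pushed c).stackAt (σ.reg .top) = c := by
  ext i
  fin_cases i <;> simp [Memory.stackAt, Memory.pushed, Memory.setReg, Memory.setArr]

theorem pushed_stackAt_of_ne {σ : Memory} {c : Cube} {k : ℤ} (hk : k ≠ σ.reg .top) :
    (σ.pushed c).stackAt k = σ.stackAt k := by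
  simp [Memory.stackAt, Memory.pushed, Memory.setReg, Memory.setArr, hk]

theorem onStack_pushed_self {σ : Memory} {c : Cube} (h : 0 ≤ σ.reg .top) :
    (σ.pushed c).OnStack c :=
  ⟨σ.reg .top, h, by rw [pushed_top]; omega, pushed_stackAt_top σ c⟩

theorem Memory.OnStack.pushed {σ : Memory} {c c' : Cube} (h : σ.OnStack c) :
    (σ.pushed c').OnStack c := by
  obtain ⟨k, h0, hk, rfl⟩ := h
  exact ⟨k, h0, by rw [pushed_top]; omega, pushed_stackAt_of_ne hk.ne⟩

theorem onStack_pushed {σ : Memory} {c c' : Cube} (h : (σ.pushed c').OnStack c) :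
    c = c' ∨ σ.OnStack c := by
  obtain ⟨k, h0, hk, rfl⟩ := h
  rw [pushed_top] at hk
  by_cases hk' : k = σ.reg .top
  · rw [hk', pushed_stackAt_top]; exact Or.inl rfl
  · exact Or.inr ⟨k, h0, by omega, (pushed_stackAt_of_ne hk').symm⟩

theorem popped_reg {σ : Memory} {r : Reg} (h : r ≠ .top) (hx : r ≠ .x) (hy : r ≠ .y) (hz : r ≠ .z) :
    σ.popped.reg r = σ.reg r := by
  simp [Memory.popped, Memory.setReg, h, hx, hy, hz]

theorem popped_top (σ : Memory) : σ.popped.reg .top = σ.reg .top - 1 := by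
  simp [Memory.popped, Memory.setReg]

theorem popped_current (σ : Memory) : σ.popped.current = σ.stackAt (σ.reg .top - 1) := by
  simp [Memory.popped, Memory.setReg, Memory.current, Memory.stackAt]

theorem onStack_popped {σ : Memory} {c : Cube} (h : σ.OnStack c) :
    c = σ.popped.current ∨ σ.popped.OnStack c := by
  obtain ⟨k, h0, hk, rfl⟩ := h
  rw [popped_current]
  by_cases hk' : k = σ.reg .top - 1
  · exact Or.inl (by rw [hk'])
  · exact Or.inr ⟨k, h0, by rw [popped_top]; omega, rfl⟩

/-! ## The invariant of the advancing surface -/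

/-- The cubes on the surface of the empty cube, where the algorithm starts. -/
def startCubes (n : ℕ) : Set Cube := {c | (∃ i, c i < 0) ∧ ∀ i, -1 ≤ c i ∧ c i < n}

/-- The cubes of the full cube. -/
noncomputable def box (n : ℕ) : Finset Cube := Fintype.piFinset fun _ => Finset.Ico 0 (n : ℤ)

theorem mem_box {n : ℕ} {c : Cube} : c ∈ box n ↔ ∀ i, 0 ≤ c i ∧ c i < n := by
  simp [box]

theorem card_box (n : ℕ) : (box n).card = n ^ 3 := by
  simp [box]

open Classical in
/-- The cubes of the full cube that have not been added. -/
noncomputable def Memory.remaining (n : ℕ) (σ : Memory) : Finset Cube :=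
  (box n).filter fun c => ¬ σ.IsAdded c

open Classical in
theorem Memory.card_remaining_le (n : ℕ) (σ : Memory) : (σ.remaining n).card ≤ n ^ 3 :=
  card_box n ▸ Finset.card_le_card (Finset.filter_subset _ _)

/-- The predecessors that the algorithm visits. -/
def IsVisited (X₂ : Set Edge) (c p : Cube) : Prop :=
  (∃ d, p = c + -unit d) ∨ (∃ d, ⟨proj c, d⟩ ∈ X₂ ∧ p = c + unit d) ∨
    ∃ d i j, i ≠ d ∧ j ≠ d ∧ i ≠ j ∧ ⟨proj (c + unit i), d⟩ ∈ X₂ ∧ p = c + (unit i - unit j)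

/-- The invariant of the algorithm, apart from the size of the stack and the progress. -/
structure Inv (n : ℕ) (X₂ : Set Edge) (σ : Memory) : Prop where
  size : σ.reg .size = n
  constraints : ∀ (d : Fin 3) (v : Vertex),
    σ.arr .constraints (d.val : ℤ) v.1 v.2 = 1 ↔ ⟨v, d⟩ ∈ X₂
  tiling : ∀ i j k, σ.arr .tiling i j k = 0
  failed : σ.reg .failed = 0 ∨ (σ.reg .failed = 1 ∧ separatingDicuts n X₂ = ∅)
  added_mem_box : ∀ c, σ.IsAdded c → c ∈ box n
  sound : ∀ c, σ.IsAdded c → ∀ D ∈ separatingDicuts n X₂, c ∈ D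
  top_nonneg : 0 ≤ σ.reg .top
  stack : ∀ c, σ.OnStack c → c ∈ startCubes n ∨ σ.IsAdded c

/-- The second memory is reached from the first one by visiting cubes. -/
structure Extends (n : ℕ) (σ σ' : Memory) : Prop where
  current : σ'.current = σ.current
  onStack : ∀ c, σ.OnStack c → σ'.OnStack c
  isAdded : ∀ c, σ.IsAdded c → σ'.IsAdded c
  new : ∀ c, σ'.IsAdded c → σ.IsAdded c ∨ σ'.OnStack c
  failed : σ.reg .failed ≠ 0 → σ'.reg .failed ≠ 0
  potential : σ'.reg .top + (σ'.remaining n).card = σ.reg .top + (σ.remaining n).card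

theorem Extends.refl (n : ℕ) (σ : Memory) : Extends n σ σ :=
  ⟨rfl, fun _ h => h, fun _ h => h, fun _ h => Or.inl h, fun h => h, rfl⟩

theorem Extends.trans {n : ℕ} {σ σ' σ'' : Memory} (h : Extends n σ σ') (h' : Extends n σ' σ'') :
    Extends n σ σ'' where
  current := h'.current.trans h.current
  onStack c hc := h'.onStack c (h.onStack c hc)
  isAdded c hc := h'.isAdded c (h.isAdded c hc)
  new c hc := (h'.new c hc).elim (fun h1 => (h.new c h1).imp_right (h'.onStack c)) Or.inr
  failed hf := h'.failed (h.failed hf)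
  potential := h'.potential.trans h.potential

theorem Extends.isBottom {n : ℕ} {σ σ' : Memory} (h : Extends n σ σ') {c : Cube}
    (hc : σ.IsBottom c) : σ'.IsBottom c := hc.imp_right (h.isAdded c)

theorem startCubes_subset_emptyCut {n : ℕ} (hn : 1 ≤ n) : startCubes n ⊆ emptyCut n := by
  rintro c ⟨hneg, hc⟩
  refine ⟨(mem_cubes hn c).2 fun i j => ?_, hneg⟩
  have hi := hc i
  have hj := hc j
  omega

theorem box_subset_cubes {n : ℕ} (hn : 1 ≤ n) {c : Cube} (hc : c ∈ box n) :
    c ∈ (hexagon n).cubes := by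
  rw [mem_box] at hc
  refine (mem_cubes hn c).2 fun i j => ?_
  have hi := hc i
  have hj := hc j
  omega

/-! ### How visiting one cube preserves the invariant -/

section

variable {n : ℕ} {X₂ : Set Edge} {σ : Memory} {W : ℕ}

theorem Inv.abs_onStack_le (h : Inv n X₂ σ) (hn : 1 ≤ n) (hW : n ≤ W) {c : Cube} (hc : σ.OnStack c)
    (i : Fin 3) : |c i| ≤ (W : ℤ) := by
  rw [abs_le]
  rcases h.stack c hc with ⟨_, h⟩ | h'
  · have := h i
    omega
  · have := mem_box.1 (h.added_mem_box c h') i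
    omega

theorem Inv.pushed (h : Inv n X₂ σ) {c : Cube} (hc : c ∈ startCubes n ∨ σ.IsAdded c) :
    Inv n X₂ (σ.pushed c) where
  size := by rw [pushed_reg (by decide), h.size]
  constraints := by rw [pushed_arr (by decide)]; exact h.constraints
  tiling := by rw [pushed_arr (by decide)]; exact h.tiling
  failed := by rw [pushed_reg (by decide)]; exact h.failed
  added_mem_box := by
    simp only [Memory.IsAdded, pushed_arr (a := .added) (by decide)]
    exact h.added_mem_box
  sound := by simp only [Memory.IsAdded, pushed_arr (a := .added) (by decide)]; exact h.sound
  top_nonneg := by rw [pushed_top]; have := h.top_nonneg; omega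
  stack c' hc' := by
    simp only [Memory.IsAdded, pushed_arr (a := .added) (by decide)]
    rcases onStack_pushed hc' with rfl | hc'
    · exact hc
    · exact h.stack c' hc'

theorem Inv.popped (h : Inv n X₂ σ) (h0 : 0 < σ.reg .top) : Inv n X₂ σ.popped where
  size := by rw [popped_reg (by decide) (by decide) (by decide) (by decide), h.size]
  constraints := h.constraints
  tiling := h.tiling
  failed := by rw [popped_reg (by decide) (by decide) (by decide) (by decide)]; exact h.failed
  added_mem_box := h.added_mem_box
  sound := h.sound
  top_nonneg := by rw [popped_top]; omega
  stack c hc := by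
    obtain ⟨k, hk, hk', rfl⟩ := hc
    rw [popped_top] at hk'
    exact h.stack _ ⟨k, hk, by omega, rfl⟩

/-- The memory after a cube was marked as added. -/
def Memory.marked (σ : Memory) (c : Cube) : Memory := σ.setArr .added (c 0) (c 1) (c 2) 1

theorem marked_isAdded (c c' : Cube) : (σ.marked c).IsAdded c' ↔ c' = c ∨ σ.IsAdded c' := by
  simp only [Memory.IsAdded, Memory.marked, Memory.setArr, true_and]
  split_ifs with h
  · simp only [true_iff]
    left
    ext i
    fin_cases i
    exacts [h.1, h.2.1, h.2.2]
  · refine ⟨Or.inr, fun h' => h'.resolve_left ?_⟩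
    rintro rfl
    exact h ⟨rfl, rfl, rfl⟩

theorem Inv.marked (h : Inv n X₂ σ) {c : Cube} (hc : c ∈ box n)
    (hD : ∀ D ∈ separatingDicuts n X₂, c ∈ D) : Inv n X₂ (σ.marked c) where
  size := h.size
  constraints := h.constraints
  tiling := h.tiling
  failed := h.failed
  added_mem_box c' hc' := by
    rcases (marked_isAdded c c').1 hc' with rfl | hc'
    exacts [hc, h.added_mem_box c' hc']
  sound c' hc' := by
    rcases (marked_isAdded c c').1 hc' with rfl | hc'
    exacts [hD, h.sound c' hc']
  top_nonneg := h.top_nonneg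
  stack c' hc' := by
    rw [marked_isAdded]
    exact (h.stack c' hc').imp_right Or.inr

/-- The cube used up here pays for its push in the potential. -/
theorem card_remaining_marked {c : Cube} (hc : c ∈ box n) (hc' : ¬ σ.IsAdded c) :
    ((σ.marked c).remaining n).card + 1 = (σ.remaining n).card := by
  classical
  have : (σ.marked c).remaining n = (σ.remaining n).erase c := by
    ext c'
    simp only [Memory.remaining, Finset.mem_filter, Finset.mem_erase, marked_isAdded]
    tauto
  rw [this, Finset.card_erase_add_one]
  simp [Memory.remaining, hc, hc']

theorem remaining_congr {σ' : Memory} (h : σ'.arr .added = σ.arr .added) :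
    σ'.remaining n = σ.remaining n := by
  have : ∀ c, σ'.IsAdded c ↔ σ.IsAdded c := fun c => by rw [Memory.IsAdded, h, Memory.IsAdded]
  ext
  simp only [Memory.remaining, Finset.mem_filter, this]

theorem extends_marked_pushed (h : Inv n X₂ σ) {c : Cube} (hc : c ∈ box n)
    (hc' : ¬ σ.IsAdded c) : Extends n σ ((σ.marked c).pushed c) := by
  have hadd : ∀ c', ((σ.marked c).pushed c).IsAdded c' ↔ c' = c ∨ σ.IsAdded c' := fun c' => by
    rw [← marked_isAdded, Memory.IsAdded, pushed_arr (by decide), ← Memory.IsAdded]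
  refine ⟨?_, fun c' h' => ?_, fun c' h' => (hadd c').2 (Or.inr h'), fun c' h' => ?_, ?_, ?_⟩
  · simp only [Memory.current, pushed_reg (r := .x) (by decide), pushed_reg (r := .y) (by decide),
      pushed_reg (r := .z) (by decide)]
    rfl
  · exact Memory.OnStack.pushed (σ := σ.marked c) h'
  · rcases (hadd c').1 h' with rfl | h'
    · exact Or.inr (onStack_pushed_self (σ := σ.marked c') h.top_nonneg)
    · exact Or.inl h'
  · rw [pushed_reg (by decide)]
    exact id
  · rw [pushed_top, remaining_congr (pushed_arr (by decide)), ← card_remaining_marked hc hc']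
    change σ.reg .top + 1 + _ = _
    push_cast
    ring

/-- Membership in all separating dicuts is only needed for cubes without negative coordinates, since
the others pass the first test and are never added. -/
theorem runs_visit (hn : 1 ≤ n) (h : Inv n X₂ σ) (v : Cube) (hW : n + 2 ≤ W)
    (htop : σ.reg .top + (σ.remaining n).card ≤ W)
    (hv : (∀ i, 0 ≤ (σ.current + v) i) → ∀ D ∈ separatingDicuts n X₂, σ.current + v ∈ D) :
    Runs W (visit v) σ 120 fun σ' => Inv n X₂ σ' ∧ Extends n σ σ' ∧
      (σ'.IsBottom (σ.current + v) ∨ σ'.reg .failed ≠ 0) := by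
  refine Runs.mono (Runs.ite (T := 80) (fun hb => ?_) fun hb => ?_)
    (by simp [inBottom, shiftX, shiftY, shiftZ, Cond.cost, Arith.cost])
    fun _ h => h
  · exact (Runs.skip ⟨h, Extends.refl n σ, Or.inl ((inBottom_eval σ v).1 hb)⟩).mono (by omega)
      fun _ h => h
  have hb : ¬ σ.IsBottom (σ.current + v) := by rw [← inBottom_eval, hb]; simp
  simp only [Memory.IsBottom, not_or, not_exists, not_lt] at hb
  refine (Runs.ite (T := 40) (fun ht => ?_) fun ht => ?_).mono
    (by simp [inTop, shiftX, shiftY, shiftZ, Cond.cost, Arith.cost]) fun _ h => h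
  · have ht : ¬ ∀ i, (σ.current + v) i < n := by rw [← h.size, ← inTop_eval, ht]; simp
    -- The cube belongs to every separating dicut but has a coordinate at least `n`, contrary to
    -- `subset_fullCut`.
    have hempty : separatingDicuts n X₂ = ∅ :=
      Set.eq_empty_of_forall_notMem fun D hD => ht (subset_fullCut hn hD (hv hb.1 D hD)).2
    refine (Runs.assign ?_ ⟨⟨h.size, h.constraints, h.tiling, Or.inr ⟨rfl, hempty⟩, h.added_mem_box,
      h.sound, h.top_nonneg, h.stack⟩, ⟨rfl, fun _ h => h, fun _ h => h, fun _ h => Or.inl h,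
      fun _ => one_ne_zero, rfl⟩, Or.inr one_ne_zero⟩).mono (by decide) fun _ h => h
    simp [Arith.eval]
    omega
  · have ht : ∀ i, (σ.current + v) i < n := by rw [← h.size, ← inTop_eval, ht]
    have hbox : σ.current + v ∈ box n := mem_box.2 fun i => ⟨hb.1 i, ht i⟩
    have habs : ∀ i, |(σ.current + v) i| ≤ (W : ℤ) := fun i => by
      have h1 := hb.1 i
      have h2 := ht i
      rw [abs_le]
      omega
    have h1 : Inv n X₂ (σ.marked (σ.current + v)) := h.marked hbox (hv hb.1)
    have hcard := card_remaining_marked hbox hb.2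
    refine Runs.seq (T := 3 + 3 + 3 + 1 + 1) (T' := 3 + 3 + 3 + 17) (Runs.store
      (vi := (σ.current + v) 0) (vj := (σ.current + v) 1) (vl := (σ.current + v) 2) (vp := 1)
      rfl rfl rfl rfl (habs 0) (habs 1) (habs 2) ?_ (runs_push (c := σ.current + v)
        ?_ ?_ ?_ habs h1.top_nonneg ?_ ?_ ?_)) |>.mono (by omega) fun _ h => h
    · rw [abs_le]; omega
    iterate 3
      · intro σ' hσ'
        simp [shiftX, shiftY, shiftZ, Arith.eval, hσ', Memory.current, Memory.marked, Memory.setArr]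
    · change σ.reg .top < W
      omega
    · omega
    · exact ⟨h1.pushed (Or.inr ((marked_isAdded _ _).2 (Or.inl rfl))),
        extends_marked_pushed h hbox hb.2, Or.inl (Or.inr (by
          rw [Memory.IsAdded, pushed_arr (by decide)]
          exact (marked_isAdded _ _).2 (Or.inl rfl)))⟩

end

/-! ## Exploring a cube -/

/-- The program, run for the current cube `c`, visits the cubes of `P`. -/
def Visits (n : ℕ) (X₂ : Set Edge) (W : ℕ) (c : Cube) (s : Prog) (T : ℕ) (P : Set Cube) : Prop :=
  ∀ σ, Inv n X₂ σ → σ.current = c → σ.reg .top + (σ.remaining n).card ≤ W →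
    Runs W s σ T fun σ' => Inv n X₂ σ' ∧ Extends n σ σ' ∧
      ∀ p ∈ P, σ'.IsBottom p ∨ σ'.reg .failed ≠ 0

section

variable {n : ℕ} {X₂ : Set Edge} {W : ℕ} {c : Cube}

theorem visits_nil : Visits n X₂ W c (block []) 1 ∅ := fun σ h _ _ =>
  Runs.skip ⟨h, Extends.refl n σ, fun _ h => h.elim⟩

theorem Visits.cons {s : Prog} {l : List Prog} {T T' : ℕ} {P P' : Set Cube}
    (h : Visits n X₂ W c s T P) (h' : Visits n X₂ W c (block l) T' P') :
    Visits n X₂ W c (block (s :: l)) (T + T') (P ∪ P') := by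
  intro σ hσ hc htop
  refine Runs.seq ((h σ hσ hc htop).mono le_rfl ?_)
  rintro σ' ⟨hσ', hext, hP⟩
  refine (h' σ' hσ' (hext.current.trans hc) (by rw [hext.potential]; exact htop)).mono le_rfl ?_
  rintro σ'' ⟨hσ'', hext', hP'⟩
  refine ⟨hσ'', hext.trans hext', fun p hp => ?_⟩
  rcases hp with hp | hp
  · exact (hP p hp).imp hext'.isBottom hext'.failed
  · exact hP' p hp

theorem visits_visit (hn : 1 ≤ n) (hW : n + 2 ≤ W) (v : Cube)
    (hv : (∀ i, 0 ≤ (c + v) i) → ∀ D ∈ separatingDicuts n X₂, c + v ∈ D) :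
    Visits n X₂ W c (visit v) 120 {c + v} := by
  intro σ hσ hc htop
  refine (runs_visit hn hσ v hW htop (by rwa [hc])).mono le_rfl ?_
  rintro σ' ⟨h1, h2, h3⟩
  exact ⟨h1, h2, fun p hp => by rwa [Set.mem_singleton_iff.1 hp, ← hc]⟩

theorem visits_ite_constrained (hn : 1 ≤ n) (hW : n + 2 ≤ W) (d : Fin 3) (u v : Cube)
    (hv : ⟨proj (c + u), d⟩ ∈ X₂ →
      (∀ i, 0 ≤ (c + v) i) → ∀ D ∈ separatingDicuts n X₂, c + v ∈ D) :
    Visits n X₂ W c (.ite (constrained d u) (visit v) .skip) 140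
      {p | ⟨proj (c + u), d⟩ ∈ X₂ ∧ p = c + v} := by
  intro σ hσ hc htop
  refine (Runs.ite (T := 120) (fun hb => ?_) fun hb => ?_).mono
    (by simp [constrained, shiftX, shiftY, shiftZ, Cond.cost, Arith.cost]) fun _ h => h
  · rw [constrained_eval, hσ.constraints, hc] at hb
    refine (visits_visit hn hW v (hv hb) σ hσ hc htop).mono le_rfl ?_
    rintro σ' ⟨h1, h2, h3⟩
    exact ⟨h1, h2, fun p hp => h3 p hp.2⟩
  · have hb : ¬ ⟨proj (c + u), d⟩ ∈ X₂ := by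
      rw [← hc, ← hσ.constraints, ← constrained_eval, hb]
      simp
    exact (Runs.skip ⟨hσ, Extends.refl n σ, fun p hp => (hb hp.1).elim⟩).mono (by omega)
      fun _ h => h

/-- Each visited predecessor has an arc to `c`, so it inherits membership in all separating dicuts.
The twelve visits cost at most `3 * 120 + 9 * 140 + 1` steps. -/
theorem visits_explore (hn : 1 ≤ n) (hW : n + 2 ≤ W)
    (hrange : ∀ i, -1 ≤ c i ∧ c i < n) (hc : ∀ D ∈ separatingDicuts n X₂, c ∈ D) :
    Visits n X₂ W c explore 1700 {p | IsVisited X₂ c p} := by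
  have below : ∀ d, Visits n X₂ W c (visitBelow d) 120 {c + -unit d} := by
    refine fun d => visits_visit hn hW _ fun hpos D hD => ?_
    have hpc : c + -unit d + unit d = c := by simp
    have harc : Arc (hexagon n) ∅ X₂ (c + -unit d) (c + -unit d + unit d) := by
      refine .ascending _ d ((proj_edge_mem_edges hn _ _).2 ?_)
      rw [hpc]
      -- The predecessor has no negative coordinate and `c` has coordinates below `n`; this keeps
      -- the arc in the hexagon.
      refine ⟨(mem_cubes hn _).2 fun i j => ?_, (mem_cubes hn _).2 fun i j => ?_⟩ <;>
      · have h1 := hrange i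
        have h2 := hpos i
        have h3 := hpos j
        have h4 := hrange j
        simp only [Pi.add_apply, Pi.neg_apply, unit_apply] at *
        split_ifs at * <;> omega
    rw [hpc] at harc
    exact hD.1.2.2.2 _ _ harc (hc D hD)
  have above : ∀ d, Visits n X₂ W c (visitAbove d) 140
      {p | ⟨proj (c + 0), d⟩ ∈ X₂ ∧ p = c + unit d} := by
    refine fun d => visits_ite_constrained hn hW d 0 _ fun he _ D hD => ?_
    rw [add_zero] at he
    exact hD.1.2.2.2 _ _ (.descending c d (Or.inr he)) (hc D hD)
  have beside : ∀ d i j, i ≠ d → j ≠ d → i ≠ j → Visits n X₂ W c (visitBeside d i j) 140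
      {p | ⟨proj (c + unit i), d⟩ ∈ X₂ ∧ p = c + (unit i - unit j)} := by
    refine fun d i j hi hj hij => visits_ite_constrained hn hW d _ _ fun he _ D hD => ?_
    have harc : Arc (hexagon n) ∅ X₂ _ _ := .lateral (c + unit i) d j i he hj hi hij.symm
    rw [add_sub_cancel_right, add_sub_assoc] at harc
    exact hD.1.2.2.2 _ _ harc (hc D hD)
  have key := (below 0).cons <| (below 1).cons <| (below 2).cons <|
    (above 0).cons <| (above 1).cons <| (above 2).cons <|
    (beside 0 1 2 (by decide) (by decide) (by decide)).cons <|
    (beside 0 2 1 (by decide) (by decide) (by decide)).cons <|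
    (beside 1 0 2 (by decide) (by decide) (by decide)).cons <|
    (beside 1 2 0 (by decide) (by decide) (by decide)).cons <|
    (beside 2 0 1 (by decide) (by decide) (by decide)).cons <|
    (beside 2 1 0 (by decide) (by decide) (by decide)).cons visits_nil
  intro σ hσ hcur htop
  refine (key σ hσ hcur htop).mono (by norm_num) ?_
  rintro σ' ⟨h1, h2, h3⟩
  refine ⟨h1, h2, fun p hp => h3 p ?_⟩
  simp only [Set.mem_union, Set.mem_singleton_iff, Set.mem_ofPred_eq, add_zero]
  rcases hp with ⟨d, rfl⟩ | ⟨d, he, rfl⟩ | ⟨d, i, j, hi, hj, hij, he, rfl⟩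
  · fin_cases d <;> simp
  · fin_cases d <;> simp_all
  · iterate 6 apply Or.inr
    have hcases : (d = 0 ∧ i = 1 ∧ j = 2) ∨ (d = 0 ∧ i = 2 ∧ j = 1) ∨ (d = 1 ∧ i = 0 ∧ j = 2) ∨
        (d = 1 ∧ i = 2 ∧ j = 0) ∨ (d = 2 ∧ i = 0 ∧ j = 1) ∨ (d = 2 ∧ i = 1 ∧ j = 0) := by
      clear * - hi hj hij
      fin_cases d <;> fin_cases i <;> fin_cases j <;> simp at hi hj hij ⊢
    rcases hcases with ⟨rfl, rfl, rfl⟩ | ⟨rfl, rfl, rfl⟩ | ⟨rfl, rfl, rfl⟩ | ⟨rfl, rfl, rfl⟩ |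
      ⟨rfl, rfl, rfl⟩ | ⟨rfl, rfl, rfl⟩
    · exact Or.inl ⟨he, rfl⟩
    · exact Or.inr (Or.inl ⟨he, rfl⟩)
    · exact Or.inr (Or.inr (Or.inl ⟨he, rfl⟩))
    · exact Or.inr (Or.inr (Or.inr (Or.inl ⟨he, rfl⟩)))
    · exact Or.inr (Or.inr (Or.inr (Or.inr (Or.inl ⟨he, rfl⟩))))
    · exact Or.inr (Or.inr (Or.inr (Or.inr (Or.inr (Or.inl ⟨he, rfl⟩)))))

/-! ## The advance of the surface -/

/-- All cubes that have to be explored are on the stack, unless they have been explored. -/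
def Pending (n : ℕ) (X₂ : Set Edge) (σ : Memory) : Prop :=
  σ.reg .failed = 0 → ∀ c, c ∈ startCubes n ∨ σ.IsAdded c →
    σ.OnStack c ∨ ∀ p, IsVisited X₂ c p → σ.IsBottom p

/-- Exploring preserves the potential, so the pop alone lowers it, by one. Unless the run has
failed, the popped cube now has all its visited predecessors in the bottom part, and newly added
cubes are on the stack. -/
theorem runs_pop_explore (hn : 1 ≤ n) (hW : n + 2 ≤ W)
    {σ : Memory} (h : Inv n X₂ σ) (hpend : Pending n X₂ σ) (h0 : 0 < σ.reg .top)
    (htop : σ.reg .top + (σ.remaining n).card ≤ W) :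
    Runs W (.seq pop explore) σ 1720 fun σ' => Inv n X₂ σ' ∧ Pending n X₂ σ' ∧
      σ'.reg .top + (σ'.remaining n).card + 1 = σ.reg .top + (σ.remaining n).card := by
  have hon : σ.OnStack (σ.stackAt (σ.reg .top - 1)) := ⟨_, by omega, by omega, rfl⟩
  have hc := h.stack _ hon
  refine Runs.seq (T := 20) (T' := 1700) (runs_pop h0 (by omega)
    (h.abs_onStack_le hn (by omega) hon) ?_)
  rw [← popped_current] at hc
  have hrem : σ.popped.remaining n = σ.remaining n := remaining_congr rfl
  have h1 := h.popped h0
  refine (visits_explore hn hW ?_ ?_ σ.popped h1 rfl ?_).mono le_rfl ?_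
  · rcases hc with hc | hc
    · exact hc.2
    · intro i
      have := mem_box.1 (h.added_mem_box _ hc) i
      omega
  · intro D hD
    rcases hc with hc | hc
    · exact emptyCut_subset hn hD (startCubes_subset_emptyCut hn hc)
    · exact h.sound _ hc D hD
  · rw [popped_top, hrem]
    omega
  · rintro σ' ⟨h2, hext, hvis⟩
    refine ⟨h2, fun hf c hc => ?_, by rw [hext.potential, popped_top, hrem]; ring⟩
    have hf' : σ.reg .failed = 0 := by
      rw [← popped_reg (σ := σ) (r := .failed) (by decide) (by decide) (by decide) (by decide)]
      by_contra hcon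
      exact hext.failed hcon hf
    have hold : c ∈ startCubes n ∨ σ.IsAdded c →
        σ'.OnStack c ∨ ∀ p, IsVisited X₂ c p → σ'.IsBottom p := by
      intro hc
      rcases hpend hf' c hc with hs | hp
      · rcases onStack_popped hs with rfl | hs
        · exact Or.inr fun p hp => (hvis p hp).resolve_right (not_not.2 hf)
        · exact Or.inl (hext.onStack c hs)
      · exact Or.inr fun p hp' => hext.isBottom (hp p hp')
    rcases hc with hc | hc
    · exact hold (Or.inl hc)
    · rcases hext.new c hc with hc | hc
      · exact hold (Or.inr hc)
      · exact Or.inl hc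

theorem runs_advance (hn : 1 ≤ n) (hW : n + 2 ≤ W)
    {σ : Memory} {M : ℕ} (h : Inv n X₂ σ) (hpend : Pending n X₂ σ)
    (htop : σ.reg .top + (σ.remaining n).card ≤ M) (hM : M ≤ W) :
    Runs W advance σ (1728 * M + 8) fun σ' => Inv n X₂ σ' ∧ (σ'.reg .failed = 0 →
      ∀ c, c ∈ startCubes n ∨ σ'.IsAdded c → ∀ p, IsVisited X₂ c p → σ'.IsBottom p) := by
  have hloop := Runs.loop (W := W) (s := .seq pop explore) (T := 1720) (σ := σ)
    (b := .and (.lt (.lit 0) (.reg .top)) (.eq (.reg .failed) (.lit 0)))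
    (P := fun σ' => Inv n X₂ σ' ∧ Pending n X₂ σ' ∧
      σ'.reg .top + (σ'.remaining n).card ≤ M)
    (fun σ' => (σ'.reg .top + (σ'.remaining n).card).toNat) ?_ ⟨h, hpend, htop⟩
  · refine hloop.mono ?_ ?_
    · have : (σ.reg .top + (σ.remaining n).card).toNat ≤ M := by omega
      exact add_le_add (Nat.mul_le_mul_left _ this) le_rfl
    · rintro σ' ⟨⟨h1, h2, -⟩, hb⟩
      refine ⟨h1, fun hf c hc => (h2 hf c hc).resolve_left ?_⟩
      rintro ⟨k, hk, hk', -⟩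
      rw [← Bool.not_eq_true, Cond.eval_and, Cond.eval_lt, Cond.eval_eq] at hb
      exact hb ⟨by simp only [Arith.eval]; omega, hf⟩
  · rintro σ' ⟨h1, h2, h3⟩ hb
    rw [Cond.eval_and, Cond.eval_lt, Cond.eval_eq] at hb
    have h0 := hb.1
    simp only [Arith.eval] at h0
    refine (runs_pop_explore hn hW h1 h2 h0 (by omega)).mono le_rfl ?_
    rintro σ'' ⟨h4, h5, h6⟩
    exact ⟨⟨h4, h5, by omega⟩, by omega⟩

end

section

variable {n : ℕ} {X₂ : Set Edge} {W : ℕ} {σ : Memory}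

/-! ## The start -/

theorem Memory.setReg_reg_self (σ : Memory) (r : Reg) (k : ℤ) : (σ.setReg r k).reg r = k := by
  simp [Memory.setReg]

theorem Memory.setReg_reg_of_ne (σ : Memory) {r r' : Reg} (k : ℤ) (h : r' ≠ r) :
    (σ.setReg r k).reg r' = σ.reg r' := by
  simp [Memory.setReg, h]

theorem Memory.onStack_setReg {r : Reg} {k : ℤ} (hr : Reg.top ≠ r) (c : Cube) :
    (σ.setReg r k).OnStack c ↔ σ.OnStack c := by
  rw [Memory.OnStack, Memory.setReg_reg_of_ne _ _ hr]
  rfl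

/-- The invariant of the first phase: nothing was added. -/
structure Fresh (n : ℕ) (X₂ : Set Edge) (σ : Memory) : Prop where
  inv : Inv n X₂ σ
  not_isAdded : ∀ c, ¬ σ.IsAdded c
  failed : σ.reg .failed = 0

theorem Fresh.pushed (h : Fresh n X₂ σ) {c : Cube} (hc : c ∈ startCubes n) :
    Fresh n X₂ (σ.pushed c) where
  inv := h.inv.pushed (Or.inl hc)
  not_isAdded := by
    simp only [Memory.IsAdded, pushed_arr (a := .added) (by decide)]
    exact h.not_isAdded
  failed := by rw [pushed_reg (by decide), h.failed]

theorem Fresh.setReg (h : Fresh n X₂ σ) {r : Reg} (hr : r = .x ∨ r = .y ∨ r = .z) (k : ℤ) :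
    Fresh n X₂ (σ.setReg r k) := by
  have hs : Reg.size ≠ r := by rintro rfl; simp at hr
  have ht : Reg.top ≠ r := by rintro rfl; simp at hr
  have hf : Reg.failed ≠ r := by rintro rfl; simp at hr
  refine ⟨⟨?_, h.inv.constraints, h.inv.tiling, ?_, h.inv.added_mem_box, h.inv.sound, ?_, ?_⟩,
    h.not_isAdded, ?_⟩
  · rw [Memory.setReg_reg_of_ne _ _ hs, h.inv.size]
  · rw [Memory.setReg_reg_of_ne _ _ hf]; exact h.inv.failed
  · rw [Memory.setReg_reg_of_ne _ _ ht]; exact h.inv.top_nonneg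
  · intro c hc
    exact h.inv.stack c ((Memory.onStack_setReg ht c).1 hc)
  · rw [Memory.setReg_reg_of_ne _ _ hf, h.failed]

/-- The three cubes that are pushed for the coordinates `p` and `q`. -/
def StartsOnStack (σ : Memory) (p q : ℤ) : Prop :=
  σ.OnStack ![-1, p, q] ∧ σ.OnStack ![p, -1, q] ∧ σ.OnStack ![p, q, -1]

theorem StartsOnStack.pushed {p q : ℤ} (h : StartsOnStack σ p q) (c : Cube) :
    StartsOnStack (σ.pushed c) p q :=
  ⟨h.1.pushed, h.2.1.pushed, h.2.2.pushed⟩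

theorem StartsOnStack.setReg {p q : ℤ} (h : StartsOnStack σ p q) {r : Reg} (hr : Reg.top ≠ r)
    (k : ℤ) : StartsOnStack (σ.setReg r k) p q := by
  simpa only [StartsOnStack, Memory.onStack_setReg hr] using h

theorem runs_pushStarts (h : Fresh n X₂ σ) {a b : ℤ} (ha : -1 ≤ a) (han : a < n) (hb : -1 ≤ b)
    (hbn : b < n) (hx : σ.reg .x = a) (hy : σ.reg .y = b) (hW : n + 2 ≤ W)
    (htop : σ.reg .top + 3 ≤ W) :
    Runs W (block [push (.lit (-1)) (.reg .x) (.reg .y), push (.reg .x) (.lit (-1)) (.reg .y),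
      push (.reg .x) (.reg .y) (.lit (-1))]) σ 61 fun σ' => Fresh n X₂ σ' ∧ σ'.reg .x = a ∧
        σ'.reg .y = b ∧ σ'.reg .top = σ.reg .top + 3 ∧ StartsOnStack σ' a b ∧
        ∀ p q, StartsOnStack σ p q → StartsOnStack σ' p q := by
  have habs : ∀ k : ℤ, -1 ≤ k → k < n → |k| ≤ (W : ℤ) := fun k h1 h2 => by rw [abs_le]; omega
  have h0 := h.inv.top_nonneg
  have c1 : ![-1, a, b] ∈ startCubes n := ⟨⟨0, by simp⟩, fun i => by fin_cases i <;> simp <;> omega⟩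
  have c2 : ![a, -1, b] ∈ startCubes n := ⟨⟨1, by simp⟩, fun i => by fin_cases i <;> simp <;> omega⟩
  have c3 : ![a, b, -1] ∈ startCubes n := ⟨⟨2, by simp⟩, fun i => by fin_cases i <;> simp <;> omega⟩
  have abs_of : ∀ {c : Cube}, c ∈ startCubes n → ∀ i, |c i| ≤ (W : ℤ) := fun hc i =>
    habs _ (hc.2 i).1 (hc.2 i).2
  have r1 : ∀ c r, r ≠ .top → (σ.pushed c).reg r = σ.reg r := fun c r hr => pushed_reg hr
  refine Runs.seq (T := 20) (T' := 41) (runs_push (c := ![-1, a, b]) ?_ ?_ ?_ (abs_of c1) h0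
    (by omega) (by omega) ?_)
  iterate 3 · intro τ hτ; simp [Arith.eval, hτ, hx, hy]
  have f1 := h.pushed c1
  set σ₁ := σ.pushed ![-1, a, b] with hσ₁
  have t1 : σ₁.reg .top = σ.reg .top + 1 := pushed_top
  have x1 : σ₁.reg .x = a := (pushed_reg (by decide)).trans hx
  have y1 : σ₁.reg .y = b := (pushed_reg (by decide)).trans hy
  refine Runs.seq (T := 20) (T' := 21) (runs_push (c := ![a, -1, b]) ?_ ?_ ?_ (abs_of c2)
    f1.inv.top_nonneg (by omega) (by omega) ?_)
  iterate 3 · intro τ hτ; simp [Arith.eval, hτ, x1, y1]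
  have f2 := f1.pushed c2
  set σ₂ := σ₁.pushed ![a, -1, b] with hσ₂
  have t2 : σ₂.reg .top = σ₁.reg .top + 1 := pushed_top
  have x2 : σ₂.reg .x = a := (pushed_reg (by decide)).trans x1
  have y2 : σ₂.reg .y = b := (pushed_reg (by decide)).trans y1
  refine Runs.seq (T := 20) (T' := 1) (runs_push (c := ![a, b, -1]) ?_ ?_ ?_ (abs_of c3)
    f2.inv.top_nonneg (by omega) (by omega) (Runs.skip ?_))
  iterate 3 · intro τ hτ; simp [Arith.eval, hτ, x2, y2]
  refine ⟨f2.pushed c3, (pushed_reg (by decide)).trans x2, (pushed_reg (by decide)).trans y2, ?_,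
    ⟨?_, ?_, onStack_pushed_self f2.inv.top_nonneg⟩, fun p q hpq =>
      ((hpq.pushed _).pushed _).pushed _⟩
  · rw [pushed_top, t2, t1]; ring
  · exact (onStack_pushed_self h0).pushed.pushed
  · exact (onStack_pushed_self f1.inv.top_nonneg).pushed

/-- Cubes with several coordinates -1 are pushed repeatedly; this is harmless, since the potential
counts stack entries and not distinct cubes. -/
theorem runs_start (h : Fresh n X₂ σ) (h0 : σ.reg .top = 0)
    (hW : n + 2 ≤ W) (htop : 3 * (n + 1) ^ 2 ≤ W) :
    Runs W start σ (69 * (n + 1) ^ 2 + 14 * (n + 1) + 6) fun σ' => Fresh n X₂ σ' ∧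
      σ'.reg .top = 3 * (n + 1) ^ 2 ∧ ∀ c ∈ startCubes n, σ'.OnStack c := by
  have hmain := Runs.forEach (W := W) (r := .x) (n := n) (σ := σ) (T := (61 + 8) * (n + 1) + 6)
    (s := forEach .y (block [push (.lit (-1)) (.reg .x) (.reg .y),
      push (.reg .x) (.lit (-1)) (.reg .y), push (.reg .x) (.reg .y) (.lit (-1))]))
    (fun a τ => Fresh n X₂ τ ∧ τ.reg .x = a ∧ τ.reg .top = 3 * (n + 1) * (a + 1) ∧
      ∀ p q : ℤ, -1 ≤ p → p < a → -1 ≤ q → q < n → StartsOnStack τ p q)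
    (by omega) (by omega) (fun k τ hτ => ⟨hτ.2.1, hτ.1.inv.size⟩)
    ⟨h.setReg (Or.inl rfl) _, Memory.setReg_reg_self _ _ _, by
      rw [Memory.setReg_reg_of_ne _ _ (by decide), h0]; ring, fun p q h1 h2 => by omega⟩ ?_
  · refine hmain.mono (le_of_eq (by ring)) ?_
    rintro τ ⟨hτ, -, ht, hon⟩
    refine ⟨hτ, by rw [ht]; ring, ?_⟩
    rintro c ⟨⟨i, hi⟩, hc⟩
    have h0 := hc 0
    have h1 := hc 1
    have h2 := hc 2
    have hci : c i = -1 := by have := hc i; omega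
    fin_cases i
    · convert (hon (c 1) (c 2) h1.1 h1.2 h2.1 h2.2).1 using 1
      ext i; fin_cases i <;> simp_all
    · convert (hon (c 0) (c 2) h0.1 h0.2 h2.1 h2.2).2.1 using 1
      ext i; fin_cases i <;> simp_all
    · convert (hon (c 0) (c 1) h0.1 h0.2 h1.1 h1.2).2.2 using 1
      ext i; fin_cases i <;> simp_all
  · rintro a σ₁ ha han ⟨f1, x1, t1, on1⟩
    refine (Runs.forEach (n := n) (T := 61)
      (fun b τ => Fresh n X₂ τ ∧ τ.reg .x = a ∧ τ.reg .y = b ∧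
        τ.reg .top = 3 * (n + 1) * (a + 1) + 3 * (b + 1) ∧
        ∀ p q : ℤ, -1 ≤ p → -1 ≤ q → (p < a ∧ q < n ∨ p = a ∧ q < b) → StartsOnStack τ p q)
      (by omega) (by omega) (fun k τ hτ => ⟨hτ.2.2.1, hτ.1.inv.size⟩)
      ⟨f1.setReg (Or.inr (Or.inl rfl)) _, ?_, Memory.setReg_reg_self _ _ _, ?_, ?_⟩ ?_).mono le_rfl ?_
    · rw [Memory.setReg_reg_of_ne _ _ (by decide), x1]
    · rw [Memory.setReg_reg_of_ne _ _ (by decide), t1]; ring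
    · intro p q hp hq hpq
      exact (on1 p q hp (by omega) hq (by omega)).setReg (by decide) _
    · rintro b σ₂ hb hbn ⟨f2, x2, y2, t2, on2⟩
      refine (runs_pushStarts f2 ha han hb hbn x2 y2 hW ?_).mono le_rfl ?_
      · have : (3 * (n + 1) * (a + 1) + 3 * (b + 1) : ℤ) + 3 ≤ W := by
          have h1 : ((3 * (n + 1) ^ 2 : ℕ) : ℤ) ≤ W := by exact_mod_cast htop
          push_cast at h1
          nlinarith
        omega
      · rintro σ₃ ⟨f3, x3, y3, t3, on3, on3'⟩
        refine ⟨y3, f3.setReg (Or.inr (Or.inl rfl)) _, ?_, Memory.setReg_reg_self _ _ _, ?_, ?_⟩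
        · rw [Memory.setReg_reg_of_ne _ _ (by decide), x3]
        · rw [Memory.setReg_reg_of_ne _ _ (by decide), t3, t2]; ring
        · intro p q hp hq hpq
          refine StartsOnStack.setReg ?_ (by decide) _
          by_cases hpq' : p = a ∧ q = b
          · rw [hpq'.1, hpq'.2]; exact on3
          · exact on3' p q (on2 p q hp hq (by omega))
    · rintro σ₂ ⟨f2, x2, y2, t2, on2⟩
      refine ⟨x2, f2.setReg (Or.inl rfl) _, Memory.setReg_reg_self _ _ _, ?_, ?_⟩
      · rw [Memory.setReg_reg_of_ne _ _ (by decide), t2]; ring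
      · intro p q hp hpa hq hqn
        exact (on2 p q hp hq (by omega)).setReg (by decide) _

/-! ## The output -/

/-- The face between the cube and its upper neighbour of direction `d` is on the surface. -/
def Memory.IsFace (σ : Memory) (c : Cube) (d : Fin 3) : Prop :=
  σ.IsBottom c ∧ ¬ σ.IsBottom (c + unit d)

/-- The output table holds the projections of those faces of the surface that satisfy `Q`. -/
structure Drawn (n : ℕ) (σ₀ : Memory) (Q : Cube → Fin 3 → Prop) (σ : Memory) : Prop where
  added : σ.arr .added = σ₀.arr .added
  size : σ.reg .size = n
  failed : σ.reg .failed = 0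
  tiling : ∀ (d : Fin 3) (v : Vertex), σ.arr .tiling (d.val : ℤ) v.1 v.2 = 1 ↔
    ∃ c, Q c d ∧ proj c = v ∧ σ₀.IsFace c d

variable {σ₀ : Memory} {Q Q' : Cube → Fin 3 → Prop}

theorem Drawn.congr (h : Drawn n σ₀ Q σ) (hQ : ∀ c d, Q c d ↔ Q' c d) : Drawn n σ₀ Q' σ :=
  ⟨h.added, h.size, h.failed, fun d v => by simp only [h.tiling, hQ]⟩

theorem Drawn.setReg (h : Drawn n σ₀ Q σ) {r : Reg} (hr : r = .x ∨ r = .y ∨ r = .z) (k : ℤ) :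
    Drawn n σ₀ Q (σ.setReg r k) := by
  have hs : Reg.size ≠ r := by rintro rfl; simp at hr
  have hf : Reg.failed ≠ r := by rintro rfl; simp at hr
  refine ⟨h.added, ?_, ?_, h.tiling⟩
  · rw [Memory.setReg_reg_of_ne _ _ hs, h.size]
  · rw [Memory.setReg_reg_of_ne _ _ hf, h.failed]

theorem runs_outputFace (h : Drawn n σ₀ Q σ) (d : Fin 3)
    (hrange : ∀ i, -1 ≤ σ.current i ∧ σ.current i < n) (hW : n + 2 ≤ W) :
    Runs W (outputFace d) σ 120 fun σ' =>
      Drawn n σ₀ (fun c d' => Q c d' ∨ c = σ.current ∧ d' = d) σ' ∧ σ'.reg = σ.reg := by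
  have hface : σ.IsFace σ.current d ↔ σ₀.IsFace σ.current d := by
    simp only [Memory.IsFace, Memory.IsBottom, Memory.IsAdded, h.added]
  refine (Runs.ite (T := 20) (fun hb => ?_) fun hb => ?_).mono
    (by simp [inBottom, shiftX, shiftY, shiftZ, Cond.cost, Arith.cost]) fun _ h => h
  · rw [Cond.eval_and, Cond.eval_not, ← Bool.not_eq_true, inBottom_eval, inBottom_eval, add_zero,
      ← Memory.IsFace, hface] at hb
    have h0 := hrange 0
    have h1 := hrange 1
    have h2 := hrange 2
    have hd : ((d.val : ℕ) : ℤ) < 3 := by exact_mod_cast d.isLt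
    refine (Runs.store (vi := (d.val : ℤ)) (vj := (proj σ.current).1) (vl := (proj σ.current).2)
      (vp := 1) rfl ?_ ?_ rfl ?_ ?_ ?_ ?_ ?_).mono
      (by simp [shiftX, shiftY, shiftZ, Arith.cost]) fun _ h => h
    · simp [Arith.eval, proj, Memory.current]
    · simp [Arith.eval, proj, Memory.current]
    · rw [abs_le]; omega
    · rw [abs_le, proj]; dsimp only; omega
    · rw [abs_le, proj]; dsimp only; omega
    · rw [abs_le]; omega
    · refine ⟨⟨h.added, h.size, h.failed, fun d' v => ?_⟩, rfl⟩
      simp only [Memory.setArr, true_and]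
      split_ifs with heq
      · simp only [true_iff]
        have hd' : d' = d := by
          ext
          exact_mod_cast heq.1
        exact ⟨σ.current, Or.inr ⟨rfl, hd'⟩, (Prod.ext heq.2.1 heq.2.2).symm, hd' ▸ hb⟩
      · rw [h.tiling]
        refine exists_congr fun c => and_congr_left fun hc =>
          ⟨Or.inl, fun hQ => hQ.resolve_right ?_⟩
        rintro ⟨rfl, rfl⟩
        exact heq ⟨rfl, by rw [hc.1], by rw [hc.1]⟩
  · refine (Runs.skip ⟨⟨h.added, h.size, h.failed, fun d' v => ?_⟩, rfl⟩).mono (by omega)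
      fun _ h => h
    rw [h.tiling]
    refine exists_congr fun c => and_congr_left fun hc =>
          ⟨Or.inl, fun hQ => hQ.resolve_right ?_⟩
    rintro ⟨rfl, rfl⟩
    rw [← Bool.not_eq_true, Cond.eval_and, Cond.eval_not, ← Bool.not_eq_true, inBottom_eval,
      inBottom_eval, add_zero, ← Memory.IsFace, hface] at hb
    exact hb hc.2

theorem runs_outputFaces (h : Drawn n σ₀ Q σ)
    (hrange : ∀ i, -1 ≤ σ.current i ∧ σ.current i < n) (hW : n + 2 ≤ W) :
    Runs W (block [outputFace 0, outputFace 1, outputFace 2]) σ 361 fun σ' =>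
      Drawn n σ₀ (fun c d => Q c d ∨ c = σ.current) σ' ∧ σ'.reg = σ.reg := by
  refine Runs.seq (T := 120) (T' := 241) ((runs_outputFace h 0 hrange hW).mono le_rfl ?_)
  rintro σ₁ ⟨h1, r1⟩
  have c1 : σ₁.current = σ.current := by simp only [Memory.current, r1]
  refine Runs.seq (T := 120) (T' := 121) ((runs_outputFace h1 1 (by rwa [c1]) hW).mono le_rfl ?_)
  rintro σ₂ ⟨h2, r2⟩
  have c2 : σ₂.current = σ.current := by simp only [Memory.current, r2, r1]
  refine Runs.seq (T := 120) (T' := 1) ((runs_outputFace h2 2 (by rwa [c2]) hW).mono le_rfl ?_)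
  rintro σ₃ ⟨h3, r3⟩
  refine Runs.skip ⟨h3.congr fun c d => ?_, r3.trans (r2.trans r1)⟩
  rw [c1, c2]
  fin_cases d <;> simp

/-- The invariants of the three nested loops say that the faces drawn so far are those at the
lexicographically earlier cubes. -/
theorem runs_output (h : Drawn n σ₀ (fun _ _ => False) σ) (hW : n + 2 ≤ W) :
    Runs W output σ ((((361 + 8) * (n + 1) + 6 + 8) * (n + 1) + 6 + 8) * (n + 1) + 6)
      (Drawn n σ₀ fun c _ => ∀ i, -1 ≤ c i ∧ c i < n) := by
  let R : Cube → Prop := fun c => ∀ i, -1 ≤ c i ∧ c i < n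
  have hR : ∀ {c : Cube}, R c → (-1 ≤ c 0 ∧ c 0 < n) ∧ (-1 ≤ c 1 ∧ c 1 < n) ∧ -1 ≤ c 2 ∧ c 2 < n :=
    fun h => ⟨h 0, h 1, h 2⟩
  refine (Runs.forEach (n := n) (fun a τ => Drawn n σ₀ (fun c _ => R c ∧ c 0 < a) τ ∧ τ.reg .x = a)
    (by omega) (by omega) (fun k τ hτ => ⟨hτ.2, hτ.1.size⟩)
    ⟨(h.setReg (Or.inl rfl) _).congr fun c _ => ?_, Memory.setReg_reg_self _ _ _⟩ ?_).mono le_rfl ?_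
  · refine iff_of_false id fun hc => ?_
    have := hR hc.1
    omega
  · rintro a σ₁ ha han ⟨h1, x1⟩
    refine (Runs.forEach (n := n) (fun b τ => Drawn n σ₀
        (fun c _ => R c ∧ (c 0 < a ∨ c 0 = a ∧ c 1 < b)) τ ∧ τ.reg .x = a ∧ τ.reg .y = b)
      (by omega) (by omega) (fun k τ hτ => ⟨hτ.2.2, hτ.1.size⟩)
      ⟨(h1.setReg (Or.inr (Or.inl rfl)) _).congr fun c _ => and_congr_right fun hc => ?_, ?_,
        Memory.setReg_reg_self _ _ _⟩ ?_).mono le_rfl ?_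
    · have := hR hc
      omega
    · rw [Memory.setReg_reg_of_ne _ _ (by decide), x1]
    · rintro b σ₂ hb hbn ⟨h2, x2, y2⟩
      refine (Runs.forEach (n := n) (fun k τ => Drawn n σ₀
          (fun c _ => R c ∧ (c 0 < a ∨ c 0 = a ∧ (c 1 < b ∨ c 1 = b ∧ c 2 < k))) τ ∧
          τ.reg .x = a ∧ τ.reg .y = b ∧ τ.reg .z = k)
        (by omega) (by omega) (fun k τ hτ => ⟨hτ.2.2.2, hτ.1.size⟩)
        ⟨(h2.setReg (Or.inr (Or.inr rfl)) _).congr fun c _ => and_congr_right fun hc => ?_, ?_, ?_,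
          Memory.setReg_reg_self _ _ _⟩ ?_).mono le_rfl ?_
      · have := hR hc
        omega
      · rw [Memory.setReg_reg_of_ne _ _ (by decide), x2]
      · rw [Memory.setReg_reg_of_ne _ _ (by decide), y2]
      · rintro k σ₃ hk hkn ⟨h3, x3, y3, z3⟩
        have hcur : σ₃.current = ![a, b, k] := by rw [Memory.current, x3, y3, z3]
        have hrange : R ![a, b, k] := fun i => by fin_cases i <;> simp <;> omega
        refine (runs_outputFaces h3 (by rw [hcur]; exact hrange) hW).mono le_rfl ?_
        rintro σ₄ ⟨h4, r4⟩
        refine ⟨by rw [r4, z3], (h4.setReg (Or.inr (Or.inr rfl)) _).congr fun c _ => ?_, ?_, ?_,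
          Memory.setReg_reg_self _ _ _⟩
        · rw [hcur]
          constructor
          · rintro (⟨hc, hc'⟩ | rfl)
            · exact ⟨hc, by omega⟩
            · exact ⟨hrange, by simp⟩
          · rintro ⟨hc, hc'⟩
            by_cases heq : c = ![a, b, k]
            · exact Or.inr heq
            · refine Or.inl ⟨hc, ?_⟩
              by_contra hcon
              apply heq
              ext i
              fin_cases i <;> simp <;> omega
        · rw [Memory.setReg_reg_of_ne _ _ (by decide), r4, x3]
        · rw [Memory.setReg_reg_of_ne _ _ (by decide), r4, y3]
      · rintro σ₃ ⟨h3, x3, y3, -⟩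
        refine ⟨y3, (h3.setReg (Or.inr (Or.inl rfl)) _).congr fun c _ => and_congr_right fun hc => ?_,
          ?_, Memory.setReg_reg_self _ _ _⟩
        · have := hR hc
          omega
        · rw [Memory.setReg_reg_of_ne _ _ (by decide), x3]
    · rintro σ₂ ⟨h2, x2, -⟩
      refine ⟨x2, (h2.setReg (Or.inl rfl) _).congr fun c _ => and_congr_right fun hc => ?_,
        Memory.setReg_reg_self _ _ _⟩
      have := hR hc
      omega
  · rintro τ ⟨hτ, -⟩
    exact hτ.congr fun c _ => ⟨fun hc => hc.1, fun hc => ⟨hc, (hc 0).2⟩⟩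

end

section

variable {n : ℕ} {X₂ : Set Edge}

/-! ## Correctness -/

theorem fresh_input {X₂ : Finset Edge} : Fresh n X₂ (input n X₂) := by
  have hadd : ∀ c, ¬ (input n X₂).IsAdded c := fun c => by simp [Memory.IsAdded, input]
  refine ⟨⟨by simp [input], fun d v => ?_, by simp [input], Or.inl (by simp [input]),
    fun c hc => (hadd c hc).elim, fun c hc => (hadd c hc).elim, by simp [input], ?_⟩, hadd,
    by simp [input]⟩
  · have : (∃ e ∈ X₂, ((e.dir.val : ℕ) : ℤ) = d ∧ e.base = (v.1, v.2)) ↔ ⟨v, d⟩ ∈ X₂ := by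
      constructor
      · rintro ⟨⟨w, d'⟩, he, h1, rfl⟩
        have : d' = d := by
          ext
          exact_mod_cast h1
        exact this ▸ he
      · exact fun h => ⟨_, h, rfl, rfl⟩
    simpa [input] using this
  · rintro c ⟨k, hk, hk', -⟩
    simp [input] at hk'
    omega

/-- The bottom part: the empty cube and the cubes that were added. -/
def Memory.bottom (n : ℕ) (σ : Memory) : Set Cube := emptyCut n ∪ {c | σ.IsAdded c}

theorem mem_bottom_iff {σ : Memory} (hn : 1 ≤ n) (h : ∀ c, σ.IsAdded c → c ∈ box n) (c : Cube) :
    c ∈ σ.bottom n ↔ c ∈ (hexagon n).cubes ∧ σ.IsBottom c := by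
  constructor
  · rintro (⟨hc, hneg⟩ | hc)
    · exact ⟨hc, Or.inl hneg⟩
    · exact ⟨box_subset_cubes hn (h c hc), Or.inr hc⟩
  · rintro ⟨hc, hneg | hadd⟩
    · exact Or.inl ⟨hc, hneg⟩
    · exact Or.inr hadd

/-- The algorithm visits all predecessors except those along boundary edges. The coordinate bound
handles bottom cubes deep below the starting surface, which are never explored. -/
theorem arc_source (hn : 1 ≤ n) (hX : X₂ ⊆ (hexagon n).interiorEdges) {c c' : Cube}
    (h : Arc (hexagon n) ∅ X₂ c c') : c ∈ (hexagon n).cubes ∧ (∀ i, c i ≤ c' i + 1) ∧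
      (IsVisited X₂ c' c ∨ ∃ d, ⟨proj c', d⟩ ∈ (hexagon n).boundary ∧ c = c' + unit d) := by
  cases h with
  | ascending _ d he =>
    refine ⟨((proj_edge_mem_edges hn c d).1 he).1, fun i => ?_, Or.inl (Or.inl ⟨d, by simp⟩)⟩
    simp only [Pi.add_apply, unit_apply]
    split_ifs <;> omega
  | descending _ d he =>
    have hle : ∀ i, (c' + unit d) i ≤ c' i + 1 := fun i => by
      simp only [Pi.add_apply, unit_apply]
      split_ifs <;> omega
    rcases he with (he | he) | he
    · exact ⟨mem_cubes_of_mem_boundary he (by simp [Edge.ends, proj_add]), hle,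
        Or.inr ⟨d, he, rfl⟩⟩
    · exact he.elim
    · exact ⟨((proj_edge_mem_edges hn c' d).1 (mem_edges_of_mem_interiorEdges (hX he)).1).2, hle,
        Or.inl (Or.inr (Or.inl ⟨d, he, rfl⟩))⟩
  | lateral c d i j he hi hj hij =>
    refine ⟨?_, fun k => ?_, Or.inl (Or.inr (Or.inr ⟨d, j, i, hj, hi, hij.symm, ?_, ?_⟩))⟩
    · obtain ⟨t, ht, hti, -⟩ := exists_triangle (proj c) hi hj hij
      have hmem : (⟨proj (c - unit i), i⟩ : Edge) ∈ (hexagon n).edges :=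
        ⟨t, hX he t (ht ▸ t.side_isSideOf d), by rw [proj_sub, ← hti]; exact t.side_isSideOf i⟩
      exact ((proj_edge_mem_edges hn _ _).1 hmem).1
    · simp only [Pi.sub_apply, unit_apply]
      split_ifs <;> omega
    · rwa [sub_add_cancel]
    · abel

theorem bottom_mem_separatingDicuts (hn : 1 ≤ n) (hX : X₂ ⊆ (hexagon n).interiorEdges)
    {σ : Memory} (h : ∀ c, σ.IsAdded c → c ∈ box n)
    (hclosed : ∀ c, c ∈ startCubes n ∨ σ.IsAdded c → ∀ p, IsVisited X₂ c p → σ.IsBottom p) :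
    σ.bottom n ∈ separatingDicuts n X₂ := by
  refine separating_of_between hn Set.subset_union_left
    (Set.union_subset (emptyCut_subset_fullCut hn) fun c hc =>
      ⟨box_subset_cubes hn (h c hc), fun i => (mem_box.1 (h c hc) i).2⟩) ?_
  intro c c' harc hc'
  obtain ⟨hc, hle, hcase⟩ := arc_source hn hX harc
  rw [mem_bottom_iff hn h]
  refine ⟨hc, ?_⟩
  rcases hcase with hvis | ⟨d, hb, rfl⟩
  · by_cases hs : c' ∈ startCubes n ∨ σ.IsAdded c'
    · exact hclosed c' hs c hvis
    · have hc' := hc'.resolve_right fun h => hs (Or.inr h)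
      -- A cube of the empty cut off the starting surface has a coordinate at most -2, which is
      -- still negative at the predecessor.
      have hns : ¬ ∀ i, -1 ≤ c' i ∧ c' i < n := fun h => hs (Or.inl ⟨hc'.2, h⟩)
      have hfull := (emptyCut_subset_fullCut hn hc').2
      push Not at hns
      obtain ⟨i, hi⟩ := hns
      refine Or.inl ⟨i, ?_⟩
      have h1 := hfull i
      have h2 := hle i
      by_contra! hcon
      have := hi (by omega)
      omega
  · rcases hc' with hc' | hc'
    · exact Or.inl (mem_emptyCut_of_boundary hn hb hc').2
    -- Coordinates of an added cube differ by less than `n`, so it does not lie over a boundary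
    -- edge.
    · obtain ⟨i, j, hij, -⟩ := sub_eq_of_mem_boundary hn hb
      have hi := mem_box.1 (h c' hc') i
      have hj := mem_box.1 (h c' hc') j
      omega

/-- The scan over `[-1, n)³` finds exactly the faces inside the hexagon that separate bottom from
top: the upper cube has no negative coordinate, so the lower one has none below -1, and the lower
one lies in `fullCut`. -/
theorem outputTiling_isSolution (hn : 1 ≤ n) (hX : X₂ ⊆ (hexagon n).interiorEdges)
    {σ₀ σ : Memory} (hbox : ∀ c, σ₀.IsAdded c → c ∈ box n)
    (hD : σ₀.bottom n ∈ separatingDicuts n X₂)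
    (h : Drawn n σ₀ (fun c _ => ∀ i, -1 ≤ c i ∧ c i < n) σ) :
    IsSolution (hexagon n) ∅ X₂ (outputTiling σ) := by
  obtain ⟨g, hg⟩ := exists_height hn hD
  have hclosed := hD.1.2.2.2
  have hfull := subset_fullCut hn hD
  have hmem := mem_bottom_iff hn hbox
  rw [hg] at hclosed hfull hmem
  have : outputTiling σ = surface n g := by
    ext L
    rw [mem_surface_iff hn hclosed, outputTiling, Set.mem_ofPred_eq, h.tiling]
    constructor
    · rintro ⟨c, hc, hp, hb, hnb⟩
      have hpos : ∀ i, 0 ≤ (c + unit L.diagonal.dir) i := fun i => by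
        by_contra! hi
        exact hnb (Or.inl ⟨i, hi⟩)
      have hcc : c ∈ (hexagon n).cubes ∧ c + unit L.diagonal.dir ∈ (hexagon n).cubes := by
        simp only [mem_cubes hn]
        refine ⟨fun i j => ?_, fun i j => ?_⟩ <;>
        · have h1 := hpos i
          have h2 := hpos j
          have h3 := hc i
          have h4 := hc j
          simp only [Pi.add_apply, unit_apply] at *
          split_ifs at * <;> omega
      exact ⟨c, (hmem c).2 ⟨hcc.1, hb⟩, hp, hcc.2, fun hcon => hnb ((hmem _).1 hcon).2⟩
    · rintro ⟨c, hc, hp, hcc, hnb⟩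
      have hnb' : ¬ σ₀.IsBottom (c + unit L.diagonal.dir) := fun hcon =>
        hnb ((hmem _).2 ⟨hcc, hcon⟩)
      refine ⟨c, fun i => ⟨?_, (hfull hc).2 i⟩, hp, ((hmem c).1 hc).2, hnb'⟩
      by_contra! hi
      refine hnb' (Or.inl ⟨i, ?_⟩)
      simp only [Pi.add_apply, unit_apply]
      split_ifs <;> omega
  rw [this]
  exact isSolution_surface hn hX hclosed

theorem runs_advancingSurface (hn : 1 ≤ n) {X₂ : Finset Edge}
    (hX : (X₂ : Set Edge) ⊆ (hexagon n).interiorEdges) :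
    Runs (30000 * n ^ 3) advancingSurface (input n X₂) (30000 * n ^ 3) fun σ =>
      (σ.reg .failed = 0 ∧ IsSolution (hexagon n) ∅ X₂ (outputTiling σ) ∧
          IsLeast (separatingDicuts n X₂) (bottomPart n σ)) ∨
        (σ.reg .failed = 1 ∧ ¬ ∃ T : Set Lozenge, IsSolution (hexagon n) ∅ X₂ T) := by
  have h1 : n ≤ n ^ 3 := Nat.le_self_pow (by norm_num) n
  have h2 : n ^ 2 ≤ n ^ 3 := Nat.pow_le_pow_right hn (by norm_num)
  have h3 : (n + 1) ^ 2 = n ^ 2 + 2 * n + 1 := by ring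
  set W := 30000 * n ^ 3 with hW
  have hW1 : n + 2 ≤ W := by omega
  have hW2 : 3 * (n + 1) ^ 2 + n ^ 3 ≤ W := by omega
  let T₁ := 69 * (n + 1) ^ 2 + 14 * (n + 1) + 6
  let T₂ := 1728 * (3 * (n + 1) ^ 2 + n ^ 3) + 8
  let T₃ := (((361 + 8) * (n + 1) + 6 + 8) * (n + 1) + 6 + 8) * (n + 1) + 6
  -- By `n ≤ n ^ 3` and `n ^ 2 ≤ n ^ 3`, a constant at least the sum of the coefficients, 25829,
  -- suffices.
  have hT : T₁ + (T₂ + (3 + 1 + T₃ + 1)) ≤ W := by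
    have h4 : T₁ + (T₂ + (3 + 1 + T₃ + 1)) = 69 * (n + 1) ^ 2 + 14 * (n + 1) + 6 +
        (1728 * (3 * (n + 1) ^ 2 + n ^ 3) + 8 + (3 + 1 + (369 * (n ^ 3 + 3 * n ^ 2 + 3 * n + 1) +
        14 * (n + 1) ^ 2 + 14 * (n + 1) + 6) + 1)) := by
      simp only [T₁, T₂, T₃]
      ring
    omega
  refine Runs.mono (Runs.seq (T := T₁) (T' := T₂ + (3 + 1 + T₃ + 1)) ?_) hT fun _ h => h
  refine (runs_start fresh_input (by simp [input]) hW1 (by omega)).mono le_rfl ?_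
  rintro σ₁ ⟨hfresh, htop, hstart⟩
  have hcard := σ₁.card_remaining_le n
  refine Runs.seq (T := T₂) (T' := 3 + 1 + T₃ + 1) ?_
  refine (runs_advance (M := 3 * (n + 1) ^ 2 + n ^ 3) hn hW1 hfresh.inv
    (fun _ c hc => Or.inl (hstart c (hc.resolve_right (hfresh.not_isAdded c)))) ?_ hW2).mono
    le_rfl ?_
  · rw [htop]
    have : ((σ₁.remaining n).card : ℤ) ≤ n ^ 3 := by exact_mod_cast hcard
    push_cast
    omega
  rintro σ₂ ⟨hinv, hdone⟩
  refine Runs.seq (T := 3 + 1 + T₃) (T' := 1) (Runs.ite (T := T₃) (fun hb => ?_) fun hb => ?_)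
  · have hf : σ₂.reg .failed = 0 := (Cond.eval_eq _ _ _).1 hb
    have hD := bottom_mem_separatingDicuts hn hX hinv.added_mem_box (hdone hf)
    refine (runs_output (σ₀ := σ₂) ⟨rfl, hinv.size, hf, fun d v => ?_⟩ hW1).mono le_rfl ?_
    · simp [hinv.tiling]
    intro σ₃ h₃
    refine Runs.skip (Or.inl ⟨h₃.failed,
      outputTiling_isSolution hn hX hinv.added_mem_box hD h₃, ?_⟩)
    have hbot : bottomPart n σ₃ = σ₂.bottom n := by
      simp only [bottomPart, Memory.bottom, Memory.IsAdded, h₃.added]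
    rw [hbot]
    exact ⟨hD, fun D hD' => Set.union_subset (emptyCut_subset hn hD') fun c hc =>
      hinv.sound c hc D hD'⟩
  · have hf : ¬ σ₂.reg .failed = 0 := fun hf => by
      rw [(Cond.eval_eq σ₂ (.reg .failed) (.lit 0)).2 hf] at hb
      exact Bool.noConfusion hb
    obtain ⟨hf, hempty⟩ := hinv.failed.resolve_left hf
    refine (Runs.skip (Runs.skip (Or.inr ⟨hf, ?_⟩))).mono (by omega) fun _ h => h
    -- A solution would yield a separating dicut, but failure certifies that none exists.
    rintro ⟨T, hT⟩
    have := below_tilingHeight_mem_separatingDicuts hn hX hT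
    rw [hempty] at this
    exact this

end

end Calisson

theorem mainTheorem5 :
    (∀ n : ℕ, 1 ≤ n →
      IsLeast (Calisson.separatingDicuts n ∅) (Calisson.emptyCut n) ∧
      IsGreatest (Calisson.separatingDicuts n ∅) (Calisson.fullCut n)) ∧
    ∃ C : ℕ, ∀ n : ℕ, 1 ≤ n → ∀ X₂ : Finset Calisson.Edge,
      (X₂ : Set Calisson.Edge) ⊆ (Calisson.hexagon n).interiorEdges →
      ∃ (t : ℕ) (σ : Calisson.Memory),
        Calisson.Exec (C * n ^ 3) Calisson.advancingSurface (Calisson.input n X₂) t σ ∧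
        t ≤ C * n ^ 3 ∧
        ((σ.reg .failed = 0 ∧
            Calisson.IsSolution (Calisson.hexagon n) ∅ X₂ (Calisson.outputTiling σ) ∧
            IsLeast (Calisson.separatingDicuts n X₂) (Calisson.bottomPart n σ)) ∨
          (σ.reg .failed = 1 ∧
            ¬ ∃ T : Set Calisson.Lozenge,
              Calisson.IsSolution (Calisson.hexagon n) ∅ X₂ T)) :=
  ⟨fun _ hn => Calisson.isLeast_emptyCut_and_isGreatest_fullCut hn,
    30000, fun _ hn _ hX => Calisson.runs_advancingSurface hn hX⟩
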